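/- **Mersenne Twister.** Let $n\ge 1$ (state size) and $w\ge 0$ (word length). The constants are $m,u,s,t,l\in\mathbb N$ and $\mathbf{upper},\mathbf a,\mathbf b,\mathbf c\in\{0,1\}^w$, with $\mathbf{lower}=\neg\,\mathbf{upper}$. Starting from a state $x[0],\dots,x[n-1]\in\{0,1\}^w$, step $i=0,1,2,\dots$ computes $$\mathbf t=(x[i \bmod n]\wedge \mathbf{upper})\vee(x[(i+1)\bmod n]\wedge\mathbf{lower}),\qquad \mathbf z=x[(i+m)\bmod n]\oplus(\mathbf t\gg 1)\oplus(\mathbf a\text{ if the lowest bit of }\mathbf t\text{ is }1,\text{ else }\mathbf 0),$$ sets $x[i\bmod n]\leftarrow \mathbf z$, and outputs the number $y_i$ obtained from $\mathbf y=\mathbf z$ by $\mathbf y\leftarrow \mathbf y\oplus(\mathbf y\gg u)$, $\mathbf y\leftarrow \mathbf y\oplus((\mathbf y\ll s)\wedge \mathbf b)$, $\mathbf y\leftarrow \mathbf y\oplus((\mathbf y\ll t)\wedge \mathbf c)$, $\mathbf y\leftarrow \mathbf y\oplus(\mathbf y\gg l)$. Let $x^{(i)}$ denote the state after $i$ steps.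 **Transformer.** Tokens are the $w$-bit numbers and a separator $\Rightarrow$. A decoder-only Transformer of hidden dimension $d$ maps the token $s_j$ at position $j=1,2,\dots$ to $\mathrm{Embed}(s_j)+\mathrm{pos}(j)\in\mathbb R^d$. It then applies layers $$\mathbf h_i=\mathbf x_i+\sum_{h=1}^{H}\Bigl(\sum_{j\le i}\mathrm{softmax}_{j\le i}\bigl(\langle \mathbf x_iW_Q^h,\mathbf x_jW_K^h\rangle/\sqrt{d_k}\bigr)\,\mathbf x_jW_V^h\Bigr)W_O^h,\qquad \mathbf x_i'=\mathbf h_i+\mathrm{GeLU}(\mathbf h_iW_1+\mathbf b_1)W_2,$$ with $W_Q^h,W_K^h,W_V^h\in\mathbb R^{d\times d_k}$, $W_O^h\in\mathbb R^{d_k\times d}$, $W_1,W_2\in\mathbb R^{d\times d}$, $\mathbf b_1\in\mathbb R^d$, $Hd_k=d$. The distribution of the next token is the softmax of a linear function (output matrix) of the last vector. Decoding is greedy: the unique most probable token is appended and the procedure is repeated. The parameters are the entries of the token embedding, of all layer weights and biases, and of the output matrix. "With rounding $\rho:\mathbb R\to\mathbb R$" means that $\rho$ is applied to every coordinate of $\mathbf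 h_i$, of the $\mathrm{GeLU}$ hidden units and of $\mathbf x_i'$, and to every output logit; $\rho=\mathrm{id}$ is exact arithmetic. **Theorem.** For every $\varepsilon>0$ there are constants $C,k\in\mathbb N$ such that for all $n\ge1$, $N\ge 0$, $w\ge 0$ and all Mersenne Twister constants as above there are a decoder-only Transformer, $p\in\mathbb N$ and $B\in\mathbb R$ with the following properties. 1. It has exactly seventeen layers, at most four attention heads in each layer, and hidden dimension $d\le C\,(n+N+w)$. (So for a fixed word length, $d=O(n)$ when $N=n$ numbers are generated.) 2. All parameters are polynomially bounded and of logarithmic precision: each is an integer multiple of $2^{-p}$ of absolute value at most $B$, where $B\le C(n+N+w)^k$ and $2^p\le C(n+N+w)^k$. 3. A token $s$ at position $j$ enters as $(\phi(s),j,1,0,\dots,0)\in\mathbb R^d$, where $d\ge w+2$, $\phi(s)\in\{0,1\}^w$ is the binary representation, and $\phi(\Rightarrow)=\mathbf 0$. 4. Let $\rho$ be any rounding with $|\rho(y)-y|\le 2^{-p}$ for all $|y|\le B$, and let $x^{(0)}\in(\{0,1\}^w)^n$ be any initial state. Started on the prompt $x^{(0)}[0]\,\dots\,x^{(0)}[n-1]\Rightarrow$,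 the Transformer with rounding $\rho$ autoregressively generates exactly the chain of thought consisting, for $i=0,1,\dots,N-1$ in this order, of the blocks $$y_i\;\;x^{(i+1)}[0]\;\cdots\;x^{(i+1)}[n-1]\;\Rightarrow .$$ So it generates the $N$ pseudo-random numbers $y_0,\dots,y_{N-1}$. Moreover, at each of these generation steps the first $w$ coordinates of the last layer's output at the last position differ from $\phi$ of the next token by at most $\varepsilon$. -/

import Mathlib

namespace MTTransformer

/-! ## Decoder-only Transformers -/

/-- The activation `GeLU(x) = x · Φ(x)`, with `Φ` the standard normal distribution function. -/
noncomputable def gelu (x : ℝ) : ℝ :=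
  x * ProbabilityTheory.cdf (ProbabilityTheory.gaussianReal 0 1) x

/-- Weights of one layer of hidden dimension `d` with `H` heads of dimension `dk = d / H`. -/
structure Layer (d : ℕ) where
  H : ℕ
  dk : ℕ
  heads : H * dk = d
  WQ : Fin H → Matrix (Fin d) (Fin dk) ℝ
  WK : Fin H → Matrix (Fin d) (Fin dk) ℝ
  WV : Fin H → Matrix (Fin d) (Fin dk) ℝ
  WO : Fin H → Matrix (Fin dk) (Fin d) ℝ
  W1 : Matrix (Fin d) (Fin d) ℝ
  b1 : Fin d → ℝ
  W2 : Matrix (Fin d) (Fin d) ℝ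

namespace Layer

variable {d L : ℕ} (lay : Layer d)

/-- Every weight and bias of the layer satisfies `P`. -/
def AllParams (P : ℝ → Prop) : Prop :=
  (∀ h i j, P (lay.WQ h i j)) ∧ (∀ h i j, P (lay.WK h i j)) ∧
  (∀ h i j, P (lay.WV h i j)) ∧ (∀ h i j, P (lay.WO h i j)) ∧
  (∀ i j, P (lay.W1 i j)) ∧ (∀ i, P (lay.b1 i)) ∧ (∀ i j, P (lay.W2 i j))

/-- Scaled dot product `⟨q_i, k_j⟩ / √d_k` in head `h`. -/
noncomputable def score (X : Fin L → Fin d → ℝ) (h : Fin lay.H) (i j : Fin L) : ℝ :=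
  (Matrix.vecMul (X i) (lay.WQ h) ⬝ᵥ Matrix.vecMul (X j) (lay.WK h)) / √(lay.dk : ℝ)

/-- Causal softmax weight of position `j` for the query position `i` (used for `j ≤ i` only). -/
noncomputable def attnWeight (X : Fin L → Fin d → ℝ) (h : Fin lay.H) (i j : Fin L) : ℝ :=
  Real.exp (lay.score X h i j) / ∑ j' ∈ Finset.Iic i, Real.exp (lay.score X h i j')

/-- Causal multi-head attention, without the residual connection. -/
noncomputable def attention (X : Fin L → Fin d → ℝ) (i : Fin L) : Fin d → ℝ :=
  ∑ h : Fin lay.H,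
    Matrix.vecMul
      (∑ j ∈ Finset.Iic i, lay.attnWeight X h i j • Matrix.vecMul (X j) (lay.WV h)) (lay.WO h)

/-- The feed-forward network `GeLU(x W₁ + b₁) W₂`, without the residual connection; the hidden
units are stored after rounding by `ρ`. -/
noncomputable def ffn (ρ : ℝ → ℝ) (x : Fin d → ℝ) : Fin d → ℝ :=
  Matrix.vecMul (fun c => ρ (gelu ((Matrix.vecMul x lay.W1 + lay.b1) c))) lay.W2

/-- Residual attention sublayer. -/
noncomputable def attnRes (ρ : ℝ → ℝ) (X : Fin L → Fin d → ℝ) (i : Fin L) : Fin d → ℝ :=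
  fun c => ρ ((lay.attention X i + X i) c)

/-- The whole layer: residual attention followed by the residual feed-forward network. Exact
real arithmetic is the case `ρ = id`. -/
noncomputable def apply (ρ : ℝ → ℝ) (X : Fin L → Fin d → ℝ) (i : Fin L) : Fin d → ℝ :=
  fun c => ρ ((lay.attnRes ρ X i + lay.ffn ρ (lay.attnRes ρ X i)) c)

end Layer

/-- A decoder-only Transformer over the vocabulary `V` with hidden dimension `d`. -/
structure Transformer (V : Type) (d : ℕ) where
  embed : V → Fin d → ℝ
  pos : ℕ → Fin d → ℝ
  layers : List (Layer d)
  unembed : V → Fin d → ℝ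

namespace Transformer

variable {V : Type} {d : ℕ} (T : Transformer V d)

/-- Every trainable parameter satisfies `P` (token embedding, all layers, output matrix). -/
def AllParams (P : ℝ → Prop) : Prop :=
  (∀ v c, P (T.embed v c)) ∧ (∀ v c, P (T.unembed v c)) ∧ ∀ lay ∈ T.layers, lay.AllParams P

/-- `Embed(s_i) + pos(i)`; positions are counted from `1`. -/
def input (s : List V) (i : Fin s.length) : Fin d → ℝ :=
  T.embed (s.get i) + T.pos (i + 1)

/-- The vectors at all positions of `s` after the last layer. -/
noncomputable def hidden (ρ : ℝ → ℝ) (s : List V) : Fin s.length → Fin d → ℝ :=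
  T.layers.foldl (fun X lay => lay.apply ρ X) (T.input s)

/-- The output vector at the last position of the (non-empty) sequence `s`. -/
noncomputable def final (ρ : ℝ → ℝ) (s : List V) : Fin d → ℝ :=
  if h : 0 < s.length then T.hidden ρ s ⟨s.length - 1, Nat.sub_lt h Nat.one_pos⟩ else 0

/-- The softmax distribution of the token that follows `s`. -/
noncomputable def nextProb [Fintype V] (ρ : ℝ → ℝ) (s : List V) (v : V) : ℝ :=
  Real.exp (ρ (T.final ρ s ⬝ᵥ T.unembed v)) / ∑ v', Real.exp (ρ (T.final ρ s ⬝ᵥ T.unembed v'))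

/-- `v` is the unique most probable token after `s`. -/
def IsNext [Fintype V] (ρ : ℝ → ℝ) (s : List V) (v : V) : Prop :=
  ∀ v', v' ≠ v → T.nextProb ρ s v' < T.nextProb ρ s v

/-- Autoregressive decoding: started on `prompt`, and with each produced token appended to the
sequence, the model produces the tokens of `out` one after the other. -/
def Generates [Fintype V] (ρ : ℝ → ℝ) (prompt out : List V) : Prop :=
  ∀ (k : ℕ) (hk : k < out.length), T.IsNext ρ (prompt ++ out.take k) out[k]

end Transformer

/-- `θ` is a fixed-point number with `p` fractional bits and absolute value at most `B`. -/
def FixedPoint (p : ℕ) (B θ : ℝ) : Prop :=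
  |θ| ≤ B ∧ ∃ z : ℤ, θ = z / 2 ^ p

/-- `ρ` is a way of rounding numbers of absolute value at most `B` with an error of at most
`2⁻ᵖ` (to nearest, to zero, up, down, fixed- or floating-point, or no rounding at all). -/
def IsRounding (p : ℕ) (B : ℝ) (ρ : ℝ → ℝ) : Prop :=
  ∀ y : ℝ, |y| ≤ B → |ρ y - y| ≤ 1 / 2 ^ p

/-! ## The Mersenne Twister -/

/-- Constants of a Mersenne Twister on `w`-bit words. The mask `upper` is arbitrary; the usual
choice is a block of leading ones. -/
structure MTParams (w : ℕ) where
  m : ℕ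
  upper : BitVec w
  a : BitVec w
  u : ℕ
  s : ℕ
  b : BitVec w
  t : ℕ
  c : BitVec w
  l : ℕ

namespace MTParams

variable {w : ℕ} (P : MTParams w)

/-- The complementary mask. -/
def lower : BitVec w := ~~~P.upper

/-- Extraction (tempering). -/
def temper (z : BitVec w) : BitVec w :=
  let y₁ := z ^^^ (z >>> P.u)
  let y₂ := y₁ ^^^ ((y₁ <<< P.s) &&& P.b)
  let y₃ := y₂ ^^^ ((y₂ <<< P.t) &&& P.c)
  y₃ ^^^ (y₃ >>> P.l)

variable {n : ℕ} [NeZero n]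

/-- Rotation (twist): the new word computed from the state `x` at index `i`.
Here `Fin.ofNat n j` is `j mod n`. -/
def rotate (x : Fin n → BitVec w) (i : ℕ) : BitVec w :=
  let t := (x (Fin.ofNat n i) &&& P.upper) ||| (x (Fin.ofNat n (i + 1)) &&& P.lower)
  x (Fin.ofNat n (i + P.m)) ^^^ (t >>> 1) ^^^ (if t.getLsbD 0 then P.a else 0#w)

/-- The state after `q` steps; step `i` overwrites the word at index `i mod n`. -/
def state (x : Fin n → BitVec w) : ℕ → Fin n → BitVec w
  | 0 => x
  | i + 1 => Function.update (state x i) (Fin.ofNat n i) (P.rotate (state x i) i)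

/-- The `i`-th generated pseudo-random number, `i = 0, 1, 2, …`. -/
def output (x : Fin n → BitVec w) (i : ℕ) : BitVec w :=
  P.temper (P.state x (i + 1) (Fin.ofNat n i))

end MTParams

/-! ## Tokens and the chain of thought -/

/-- A token is a `w`-bit number or the separator `⇒` (`none`). -/
abbrev Token (w : ℕ) : Type := Option (BitVec w)

/-- The binary representation of a token, least significant bit first, continued by zeros from
index `w` on; the separator is represented by zeros. -/
def bit {w : ℕ} : Token w → ℕ → ℝ
  | none, _ => 0
  | some v, c => if v.getLsbD c then 1 else 0

section CoT

variable {w n : ℕ}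

/-- `x₀ … x_{n-1} ⇒` -/
def prompt (x : Fin n → BitVec w) : List (Token w) :=
  (List.ofFn x).map some ++ [none]

/-- `y x₀ … x_{n-1} ⇒`, with `y` the `i`-th generated number, `x` the state after that step. -/
def cotBlock [NeZero n] (P : MTParams w) (x : Fin n → BitVec w) (i : ℕ) : List (Token w) :=
  some (P.output x i) :: ((List.ofFn (P.state x (i + 1))).map some ++ [none])

/-- The chain of thought that generates `N` numbers from the initial state `x`. -/
def cot [NeZero n] (P : MTParams w) (x : Fin n → BitVec w) (N : ℕ) : List (Token w) :=
  (List.range N).flatMap (cotBlock P x)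

end CoT

/-- The token `s` at position `j` enters the Transformer as `(φ(s), j, 1, 0, …, 0)`. -/
def BinaryInput {w d : ℕ} (T : Transformer (Token w) d) : Prop :=
  w + 2 ≤ d ∧ (∀ v (c : Fin d), T.embed v c = bit v c) ∧
  ∀ (j : ℕ) (c : Fin d),
    T.pos j c = if (c : ℕ) = w then (j : ℝ) else if (c : ℕ) = w + 1 then 1 else 0

/-- Whenever the model is about to produce the next token of `out`, the first `w` coordinates of
its output vector are the bits of that token up to an error `ε`. -/
def ApproximatesBits {w d : ℕ} (T : Transformer (Token w) d) (ρ : ℝ → ℝ) (ε : ℝ)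
    (prompt out : List (Token w)) : Prop :=
  ∀ (k : ℕ) (hk : k < out.length) (c : Fin d), (c : ℕ) < w →
    |T.final ρ (prompt ++ out.take k) c - bit out[k] c| ≤ ε

end MTTransformer

/-! The chain of thought writes out the whole state after every step, so the next token depends only
on a few words of the preceding block and on the place of the current position in its own block. It
is a separator, a word copied from the preceding block, the newly computed word, or the tempering of
that word. The new word is built from three words of the preceding block. Masks and shifts are
constants, so the remaining work is a fixed number of parities of at most three bits, done for all
bits in parallel.

This gives an exact machine on integer registers. Each of its layers acts either by rectifiers alone
or by hard attention alone (`Gates.Step`). Positions are first decomposed into a one-hot block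
number and a one-hot place; with these, retrieving a word is an attention score with a unique
integer maximum. `step_mtGates` checks every layer, and `seqTok_succ` shows that from block 1 on the
machine predicts the next token. Thirteen layers with one head each do the work; the other four are
idle.

The real Transformer follows this machine because scores and hidden units are scaled by `2 ^ p`.
`GeLU` differs from the rectifier by a bounded amount (`abs_gelu_sub_max_le`), so the scaled unit is
a rectifier up to order `2 ^ (-p)`. An integer score gap leaves the wrong positions a softmax weight
of order `R / 2 ^ p`. With all weights and contents at most `R`, polynomial in `n + N + w`, a layer
multiplies the error by at most `R ^ 11` (`Gates.apply_approx`), so seventeen layers cost `R ^ 187`.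
The exact logits are integers with a unique maximum, so a small error keeps their order
(`isNext_of_approx`). Hence `2 ^ p` of polynomial size suffices, that is, logarithmic precision. -/

namespace MTTransformer

/-! ### GeLU compared with the rectifier. -/

open ProbabilityTheory MeasureTheory in
lemma abs_mul_gaussian_tail_le (x : ℝ) :
    |x| * (gaussianReal 0 1).real {z | |x| ≤ |z|} ≤ 1 := by
  rcases le_or_gt |x| 1 with h | h
  · exact mul_le_one₀ h measureReal_nonneg measureReal_le_one
  · have h0 : 0 < |x| := by linarith
    -- Chebyshev's inequality with variance 1 bounds the tail by `1 / x ^ 2`; this crude bound is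
    -- enough.
    have hc := meas_ge_le_variance_div_sq (μ := gaussianReal 0 1) (X := id)
      (memLp_id_gaussianReal 2) h0
    simp only [variance_id_gaussianReal, id_eq, integral_id_gaussianReal] at hc
    have hr : (gaussianReal 0 1).real {z | |x| ≤ |z|} ≤ 1 / |x| ^ 2 := by
      refine ENNReal.toReal_le_of_le_ofReal (by positivity) ?_
      simpa using hc
    calc |x| * (gaussianReal 0 1).real {z | |x| ≤ |z|} ≤ |x| * (1 / |x| ^ 2) := by gcongr
      _ = 1 / |x| := by field_simp
      _ ≤ 1 := by rw [div_le_one h0]; exact h.le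

open ProbabilityTheory MeasureTheory in
/-- `GeLU` is the rectifier up to a bounded error. -/
lemma abs_gelu_sub_max_le (x : ℝ) : |gelu x - max 0 x| ≤ 1 := by
  have ht := abs_mul_gaussian_tail_le x
  rw [gelu, cdf_eq_real]
  -- For either sign the difference is `|x|` times the Gaussian mass of one tail beyond `x`, which
  -- lies inside the two-sided tail.
  rcases le_total 0 x with h | h
  · have hs : (gaussianReal 0 1).real (Set.Iic x) = 1 - (gaussianReal 0 1).real (Set.Ioi x) := by
      rw [← probReal_compl_eq_one_sub measurableSet_Ioi, Set.compl_Ioi]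
    have hm : (gaussianReal 0 1).real (Set.Ioi x) ≤ (gaussianReal 0 1).real {z | |x| ≤ |z|} := by
      refine measureReal_mono fun z hz => ?_
      rw [Set.mem_Ioi] at hz
      simp only [Set.mem_ofPred_eq]
      rw [abs_of_nonneg h]
      exact hz.le.trans (le_abs_self z)
    rw [hs, max_eq_right h, show x * (1 - (gaussianReal 0 1).real (Set.Ioi x)) - x =
      -(x * (gaussianReal 0 1).real (Set.Ioi x)) by ring, abs_neg, abs_mul,
      abs_of_nonneg (measureReal_nonneg (μ := gaussianReal 0 1) (s := Set.Ioi x))]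
    exact (mul_le_mul_of_nonneg_left hm (abs_nonneg x)).trans ht
  · have hm : (gaussianReal 0 1).real (Set.Iic x) ≤ (gaussianReal 0 1).real {z | |x| ≤ |z|} := by
      refine measureReal_mono fun z hz => ?_
      rw [Set.mem_Iic] at hz
      simp only [Set.mem_ofPred_eq]
      rw [abs_of_nonpos h, abs_of_nonpos (hz.trans h)]
      linarith
    rw [max_eq_left h, sub_zero, abs_mul,
      abs_of_nonneg (measureReal_nonneg (μ := gaussianReal 0 1) (s := Set.Iic x))]
    exact (mul_le_mul_of_nonneg_left hm (abs_nonneg x)).trans ht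

/-- A single-head layer given by integer matrices: `M` is the bilinear form of the attention
scores, `V` the value map, `A` and `C` the two maps of the feed-forward network. Scores and hidden
units are scaled by `Λ`, which sharpens the softmax and turns `GeLU` into a rectifier. -/
noncomputable def sharpLayer {d : ℕ} (Λ : ℝ) (M V A C : Matrix (Fin d) (Fin d) ℤ) : Layer d where
  H := 1
  dk := d
  heads := one_mul d
  WQ _ := Matrix.of fun i j => Λ * M i j
  WK _ := 1
  WV _ := Matrix.of fun i j => (V i j : ℝ)
  WO _ := 1
  W1 := Matrix.of fun i j => Λ * A i j
  b1 := 0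
  W2 := Matrix.of fun i j => (C i j : ℝ) / Λ

/-! ### Error analysis of a single sharpened layer. -/

section

variable {d L : ℕ} {Λ : ℝ} {M V A C : Matrix (Fin d) (Fin d) ℤ}

lemma score_sharpLayer (X : Fin L → Fin d → ℝ) (h) (i j : Fin L) :
    (sharpLayer Λ M V A C).score X h i j =
      Λ * (∑ b, (∑ a, X i a * M a b) * X j b) / √(d : ℝ) := by
  simp only [Layer.score, sharpLayer, Matrix.vecMul_one]
  congr 1
  simp only [dotProduct, Matrix.vecMul, Matrix.of_apply, Finset.mul_sum, Finset.sum_mul]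
  exact Finset.sum_congr rfl fun b _ => Finset.sum_congr rfl fun a _ => by ring

lemma attention_sharpLayer (X : Fin L → Fin d → ℝ) (i : Fin L) (c : Fin d) :
    (sharpLayer Λ M V A C).attention X i c =
      ∑ j ∈ Finset.Iic i,
        Real.exp (Λ * (∑ b, (∑ a, X i a * M a b) * X j b) / √(d : ℝ)) /
          (∑ j' ∈ Finset.Iic i, Real.exp (Λ * (∑ b, (∑ a, X i a * M a b) * X j' b) / √(d : ℝ))) *
        ∑ a, X j a * V a c := by
  have h : (sharpLayer Λ M V A C).attention X i =
      ∑ _h : Fin 1, Matrix.vecMul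
      (∑ j ∈ Finset.Iic i,
        (Real.exp (Λ * (∑ b, (∑ a, X i a * M a b) * X j b) / √(d : ℝ)) /
          (∑ j' ∈ Finset.Iic i, Real.exp (Λ * (∑ b, (∑ a, X i a * M a b) * X j' b) / √(d : ℝ)))) •
        Matrix.vecMul (X j) (Matrix.of fun i j => (V i j : ℝ))) 1 := by
    simp only [Layer.attention, Layer.attnWeight, score_sharpLayer]
    rfl
  rw [h]
  simp [Finset.sum_apply, Matrix.vecMul, dotProduct]

lemma ffn_sharpLayer (ρ : ℝ → ℝ) (x : Fin d → ℝ) (c : Fin d) :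
    (sharpLayer Λ M V A C).ffn ρ x c =
      ∑ u, ρ (gelu (Λ * ∑ a, x a * A a u)) * (C u c / Λ) := by
  simp only [Layer.ffn, sharpLayer, Matrix.vecMul, dotProduct, Matrix.of_apply, Pi.add_apply,
    Pi.zero_apply, add_zero, Finset.mul_sum]
  refine Finset.sum_congr rfl fun u _ => ?_
  congr 3
  exact Finset.sum_congr rfl fun a _ => by ring

lemma abs_sum_mul_le {ι : Type*} [Fintype ι] {x y : ι → ℝ} {a b R : ℝ} (ha : 0 ≤ a) (hb : 0 ≤ b)
    (hcard : (Fintype.card ι : ℝ) ≤ R) (hx : ∀ i, |x i| ≤ a) (hy : ∀ i, |y i| ≤ b) :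
    |∑ i, x i * y i| ≤ R * (a * b) := by
  calc |∑ i, x i * y i| ≤ ∑ i, |x i * y i| := Finset.abs_sum_le_sum_abs _ _
    _ ≤ ∑ _i : ι, a * b := Finset.sum_le_sum fun i _ => by
        rw [abs_mul]; exact mul_le_mul (hx i) (hy i) (abs_nonneg _) ha
    _ = Fintype.card ι * (a * b) := by simp
    _ ≤ R * (a * b) := by gcongr

/-- The feed-forward sublayer computes the exact rectifier network up to a small error. -/
lemma ffn_approx {p : ℕ} {B R η : ℝ} {ρ : ℝ → ℝ} (hρ : IsRounding p B ρ) (hR : 9 ≤ R)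
    (hd : (d : ℝ) ≤ R) (hB : 2 ^ p * R ^ 4 ≤ B) (hη : 1 / 2 ^ p ≤ η) (hη1 : R ^ 5 * η ≤ 1)
    (hA : ∀ a u, |(A a u : ℝ)| ≤ R) (hC : ∀ u c, |(C u c : ℝ)| ≤ R)
    {x : Fin d → ℝ} {y z : Fin d → ℤ} (hxy : ∀ c, |x c - y c| ≤ η) (hy : ∀ c, |(y c : ℝ)| ≤ R)
    (hz : ∀ c, |(z c : ℝ)| ≤ R)
    (hyz : ∀ c, z c = y c + ∑ u, max 0 (∑ a, y a * A a u) * C u c) (c : Fin d) :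
    |ρ (x c + (sharpLayer (2 ^ p) M V A C).ffn ρ x c) - z c| ≤ R ^ 5 * η := by
  have hΛ : (1 : ℝ) ≤ 2 ^ p := one_le_pow₀ (by norm_num)
  have hΛ0 : (0 : ℝ) < 2 ^ p := by positivity
  have hδ0 : (0 : ℝ) < 1 / 2 ^ p := by positivity
  have hδ1 : (1 : ℝ) / 2 ^ p ≤ 1 := by rw [div_le_one hΛ0]; exact hΛ
  have hη0 : 0 < η := hδ0.trans_le hη
  have hRη : η ≤ 1 := by
    have : 1 ≤ R ^ 5 := one_le_pow₀ (by linarith)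
    nlinarith
  have hR2 : 81 ≤ R ^ 2 := by nlinarith
  have hR3 : 9 * R ^ 2 ≤ R ^ 3 := by nlinarith
  have hR4 : 9 * R ^ 3 ≤ R ^ 4 := by nlinarith
  have hR5 : 9 * R ^ 4 ≤ R ^ 5 := by nlinarith
  have hcard : (Fintype.card (Fin d) : ℝ) ≤ R := by simpa using hd
  set pre : Fin d → ℝ := fun u => ∑ a, x a * A a u with hpre
  have hdiff (u) : |pre u - ((∑ a, y a * A a u : ℤ) : ℝ)| ≤ R ^ 2 * η := by
    have : pre u - ((∑ a, y a * A a u : ℤ) : ℝ) = ∑ a, (x a - y a) * A a u := by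
      push_cast
      rw [hpre, ← Finset.sum_sub_distrib]
      exact Finset.sum_congr rfl fun a _ => by ring
    rw [this]
    calc _ ≤ R * (η * R) := abs_sum_mul_le hη0.le (by linarith) hcard hxy (fun a => hA a u)
      _ = R ^ 2 * η := by ring
  have hxb (a) : |x a| ≤ R + 1 := by
    have := abs_sub_abs_le_abs_sub (x a) (y a)
    linarith [hxy a, hy a]
  have hpreb (u) : |pre u| ≤ R ^ 3 + R ^ 2 := by
    calc _ ≤ R * ((R + 1) * R) :=
          abs_sum_mul_le (by linarith) (by linarith) hcard hxb (fun a => hA a u)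
      _ = R ^ 3 + R ^ 2 := by ring
  -- On the scaled unit, replacing `GeLU` by the rectifier and rounding cost at most 1 each;
  -- division by `2 ^ p` turns this into `2 * η`. The input error enters through the 1-Lipschitz
  -- rectifier.
  have hhid (u) : |ρ (gelu (2 ^ p * pre u)) / 2 ^ p - max 0 ((∑ a, y a * A a u : ℤ) : ℝ)| ≤
      2 * η + R ^ 2 * η := by
    have h1 := abs_gelu_sub_max_le (2 ^ p * pre u)
    have h2 : |gelu (2 ^ p * pre u)| ≤ B := by
      have h3 : |max 0 (2 ^ p * pre u)| ≤ 2 ^ p * (R ^ 3 + R ^ 2) := by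
        rw [abs_of_nonneg (le_max_left _ _)]
        refine max_le (by positivity) ?_
        exact mul_le_mul_of_nonneg_left ((le_abs_self _).trans (hpreb u)) hΛ0.le
      have h4 := abs_sub_abs_le_abs_sub (gelu (2 ^ p * pre u)) (max 0 (2 ^ p * pre u))
      -- The scaled hidden units are the largest numbers to be rounded; they dictate the assumption
      -- `2 ^ p * R ^ 4 ≤ B`.
      have h5 : 2 ^ p * (R ^ 3 + R ^ 2 + 1) ≤ 2 ^ p * R ^ 4 :=
        mul_le_mul_of_nonneg_left (by nlinarith) hΛ0.le
      linarith
    have h3 := hρ _ h2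
    have h4 : |ρ (gelu (2 ^ p * pre u)) - max 0 (2 ^ p * pre u)| ≤ 2 := by
      rw [abs_le] at *
      constructor <;> linarith [h1.1, h1.2, h3.1, h3.2]
    have h5 : max 0 (2 ^ p * pre u) = 2 ^ p * max 0 (pre u) := by
      rw [mul_max_of_nonneg _ _ hΛ0.le, mul_zero]
    have h6 : |ρ (gelu (2 ^ p * pre u)) / 2 ^ p - max 0 (pre u)| ≤ 2 * η := by
      have : ρ (gelu (2 ^ p * pre u)) / 2 ^ p - max 0 (pre u) =
          (ρ (gelu (2 ^ p * pre u)) - max 0 (2 ^ p * pre u)) * (1 / 2 ^ p) := by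
        rw [h5]; field_simp
      rw [this, abs_mul, abs_of_pos hδ0]
      exact mul_le_mul h4 hη hδ0.le (by norm_num)
    have h7 : |max 0 (pre u) - max 0 ((∑ a, y a * A a u : ℤ) : ℝ)| ≤ R ^ 2 * η :=
      (abs_max_sub_max_le_max _ _ _ _).trans (max_le (by simpa using by positivity) (hdiff u))
    rw [abs_le] at *
    constructor <;> linarith [h6.1, h6.2, h7.1, h7.2]
  have hsum : |x c + (sharpLayer (2 ^ p) M V A C).ffn ρ x c - z c| ≤
      η + R * ((2 * η + R ^ 2 * η) * R) := by
    have : x c + (sharpLayer (2 ^ p) M V A C).ffn ρ x c - z c = (x c - y c) +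
        ∑ u, (ρ (gelu (2 ^ p * pre u)) / 2 ^ p - max 0 ((∑ a, y a * A a u : ℤ) : ℝ)) * C u c := by
      have hzc : (z c : ℝ) = y c + ∑ u, max 0 ((∑ a, y a * A a u : ℤ) : ℝ) * C u c := by
        rw [hyz c]; push_cast; rfl
      rw [hzc, ffn_sharpLayer]
      have : ∑ u, ρ (gelu (2 ^ p * ∑ a, x a * A a u)) * (C u c / 2 ^ p) =
          ∑ u, ρ (gelu (2 ^ p * pre u)) / 2 ^ p * C u c :=
        Finset.sum_congr rfl fun u _ => by rw [hpre]; ring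
      rw [this]
      simp only [sub_mul, Finset.sum_sub_distrib]
      ring
    rw [this]
    exact (abs_add_le _ _).trans (add_le_add (hxy c)
      (abs_sum_mul_le (by positivity) (by linarith) hcard hhid fun u => hC u c))
  -- The last `η` pays for rounding the output.
  have htot : η + R * ((2 * η + R ^ 2 * η) * R) + η ≤ R ^ 5 * η := by
    have : η + R * ((2 * η + R ^ 2 * η) * R) + η = (2 + 2 * R ^ 2 + R ^ 4) * η := by ring
    rw [this]
    exact mul_le_mul_of_nonneg_right (by nlinarith) hη0.le
  have hb : |x c + (sharpLayer (2 ^ p) M V A C).ffn ρ x c| ≤ B := by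
    have h4 := abs_sub_abs_le_abs_sub (x c + (sharpLayer (2 ^ p) M V A C).ffn ρ x c) (z c)
    have : R ^ 4 ≤ 2 ^ p * R ^ 4 := le_mul_of_one_le_left (by positivity) hΛ
    nlinarith [hz c]
  have hr := hρ _ hb
  rw [abs_le] at *
  constructor <;> linarith [hr.1, hr.2, hsum.1, hsum.2]

/-- If one score exceeds the others by at least `g`, the softmax average is close to the value
at the best position. -/
lemma softmax_average_approx {ι : Type*} [DecidableEq ι] {s : Finset ι} {τ : ι} (hτ : τ ∈ s)
    {f v : ι → ℝ} {g a b R t : ℝ} (hg : 0 < g) (hgap : ∀ j ∈ s, j ≠ τ → f j + g ≤ f τ)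
    (ha : |v τ - t| ≤ a) (hb0 : 0 ≤ b) (hb : ∀ j ∈ s, |v j - t| ≤ b)
    (hs : (s.card : ℝ) ≤ R) :
    |∑ j ∈ s, Real.exp (f j) / (∑ j' ∈ s, Real.exp (f j')) * v j - t| ≤ a + R * (b / g) := by
  set Z := ∑ j' ∈ s, Real.exp (f j') with hZ
  have hle (j) (hj : j ∈ s) : Real.exp (f j) ≤ Z :=
    Finset.single_le_sum (f := fun j => Real.exp (f j)) (fun _ _ => (Real.exp_pos _).le) hj
  have hZ0 : 0 < Z := (Real.exp_pos _).trans_le (hle τ hτ)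
  have hone : ∑ j ∈ s, Real.exp (f j) / Z = 1 := by
    rw [← Finset.sum_div, ← hZ, div_self hZ0.ne']
  -- `exp (-g) ≤ 1 / g` wastes the exponential decay, but a polynomially large gap `g` is affordable
  -- here.
  have hw (j) (hj : j ∈ s) (hne : j ≠ τ) : Real.exp (f j) / Z ≤ 1 / g := by
    have h1 : Real.exp (f j) / Z ≤ Real.exp (f j) / Real.exp (f τ) :=
      div_le_div_of_nonneg_left (Real.exp_pos _).le (Real.exp_pos _) (hle τ hτ)
    have h2 : Real.exp (f j) / Real.exp (f τ) ≤ Real.exp (-g) := by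
      rw [← Real.exp_sub]
      exact Real.exp_le_exp.2 (by linarith [hgap j hj hne])
    have h3 : Real.exp (-g) ≤ 1 / g := by
      rw [Real.exp_neg, ← one_div]
      exact one_div_le_one_div_of_le hg (by linarith [Real.add_one_le_exp g])
    exact h1.trans (h2.trans h3)
  have hsplit : ∑ j ∈ s, Real.exp (f j) / Z * v j - t =
      ∑ j ∈ s, Real.exp (f j) / Z * (v j - t) := by
    simp only [mul_sub, Finset.sum_sub_distrib, ← Finset.sum_mul, hone, one_mul]
  have hbg : 0 ≤ b / g := div_nonneg hb0 hg.le
  rw [hsplit, ← Finset.add_sum_erase s _ hτ]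
  refine (abs_add_le _ _).trans (add_le_add ?_ ?_)
  · rw [abs_mul, abs_of_nonneg (div_nonneg (Real.exp_pos _).le hZ0.le)]
    refine (mul_le_of_le_one_left (abs_nonneg _) ?_).trans ha
    rw [div_le_one hZ0]
    exact hle τ hτ
  · calc |∑ j ∈ s.erase τ, Real.exp (f j) / Z * (v j - t)|
        ≤ ∑ j ∈ s.erase τ, |Real.exp (f j) / Z * (v j - t)| := Finset.abs_sum_le_sum_abs _ _
      _ ≤ ∑ _j ∈ s.erase τ, b / g := Finset.sum_le_sum fun j hj => by
          obtain ⟨hne, hj⟩ := Finset.mem_erase.1 hj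
          rw [abs_mul, abs_of_nonneg (div_nonneg (Real.exp_pos _).le hZ0.le),
            show b / g = 1 / g * b by ring]
          exact mul_le_mul (hw j hj hne) (hb j hj) (abs_nonneg _) (by positivity)
      _ = (s.erase τ).card * (b / g) := by simp
      _ ≤ R * (b / g) := by
          refine mul_le_mul_of_nonneg_right (le_trans ?_ hs) hbg
          exact_mod_cast Finset.card_erase_le

/-- The attention sublayer fetches the value at the position of strictly largest integer score,
up to a small error. -/
lemma attnRes_approx {p : ℕ} {B R η : ℝ} {ρ : ℝ → ℝ} (hρ : IsRounding p B ρ) (hR : 9 ≤ R)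
    (hd : (d : ℝ) ≤ R) (hd0 : 0 < d) (hL : (L : ℝ) ≤ R) (hB : 2 ^ p * R ^ 4 ≤ B)
    (hη : 1 / 2 ^ p ≤ η) (hη1 : R ^ 6 * η ≤ 1)
    (hM : ∀ a u, |(M a u : ℝ)| ≤ R) (hV : ∀ u c, |(V u c : ℝ)| ≤ R)
    {X : Fin L → Fin d → ℝ} {Y : Fin L → Fin d → ℤ} (hXY : ∀ i c, |X i c - Y i c| ≤ η)
    (hY : ∀ i c, |(Y i c : ℝ)| ≤ R) {i τ : Fin L} (hτ : τ ≤ i)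
    (hmax : ∀ j ≤ i, j ≠ τ →
      ∑ b, (∑ a, Y i a * M a b) * Y j b < ∑ b, (∑ a, Y i a * M a b) * Y τ b)
    {z : Fin d → ℤ} (hz : ∀ c, |(z c : ℝ)| ≤ R)
    (hyz : ∀ c, z c = Y i c + ∑ a, Y τ a * V a c) (c : Fin d) :
    |(sharpLayer (2 ^ p) M V A C).attnRes ρ X i c - z c| ≤ R ^ 6 * η := by
  have hΛ : (1 : ℝ) ≤ 2 ^ p := one_le_pow₀ (by norm_num)
  have hΛ0 : (0 : ℝ) < 2 ^ p := by positivity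
  have hδ0 : (0 : ℝ) < 1 / 2 ^ p := by positivity
  have hη0 : 0 < η := hδ0.trans_le hη
  have hR0 : 0 < R := by linarith
  have hR2 : 81 ≤ R ^ 2 := by nlinarith
  have hR3 : 9 * R ^ 2 ≤ R ^ 3 := by nlinarith
  have hR4 : 9 * R ^ 3 ≤ R ^ 4 := by nlinarith
  have hR5 : 9 * R ^ 4 ≤ R ^ 5 := by nlinarith
  have hR6 : 9 * R ^ 5 ≤ R ^ 6 := by nlinarith
  have hRη : 81 * (R ^ 4 * η) ≤ 1 := by nlinarith
  have hη2 : η ≤ 1 := by nlinarith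
  have hcard : (Fintype.card (Fin d) : ℝ) ≤ R := by simpa using hd
  have hXb (j a) : |X j a| ≤ R + 1 := by
    have := abs_sub_abs_le_abs_sub (X j a) (Y j a)
    linarith [hXY j a, hY j a]
  -- Exact scores are integers, so an error of 1/4 in each leaves a gap of at least 1/2 between the
  -- best one and the others.
  have hscore (j) : |∑ b, (∑ a, X i a * M a b) * X j b -
      ((∑ b, (∑ a, Y i a * M a b) * Y j b : ℤ) : ℝ)| ≤ 1 / 4 := by
    have hq (b) : |∑ a, X i a * M a b - ∑ a, (Y i a : ℝ) * M a b| ≤ R ^ 2 * η := by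
      rw [← Finset.sum_sub_distrib]
      simp only [← sub_mul]
      calc _ ≤ R * (η * R) := abs_sum_mul_le hη0.le (by linarith) hcard (hXY i) (fun a => hM a b)
        _ = R ^ 2 * η := by ring
    have hqb (b) : |∑ a, (Y i a : ℝ) * M a b| ≤ R ^ 3 := by
      calc _ ≤ R * (R * R) := abs_sum_mul_le hR0.le (by linarith) hcard (hY i) (fun a => hM a b)
        _ = R ^ 3 := by ring
    have : ∑ b, (∑ a, X i a * M a b) * X j b -
        ((∑ b, (∑ a, Y i a * M a b) * Y j b : ℤ) : ℝ) =
        ∑ b, (∑ a, X i a * M a b - ∑ a, (Y i a : ℝ) * M a b) * X j b +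
        ∑ b, (∑ a, (Y i a : ℝ) * M a b) * (X j b - Y j b) := by
      push_cast
      rw [← Finset.sum_sub_distrib, ← Finset.sum_add_distrib]
      exact Finset.sum_congr rfl fun b _ => by ring
    rw [this]
    calc _ ≤ R * (R ^ 2 * η * (R + 1)) + R * (R ^ 3 * η) :=
          (abs_add_le _ _).trans (add_le_add
            (abs_sum_mul_le (by positivity) (by linarith) hcard hq (hXb j))
            (abs_sum_mul_le (by positivity) hη0.le hcard hqb (hXY j)))
      _ = (2 * R ^ 4 + R ^ 3) * η := by ring
      _ ≤ 3 * (R ^ 4 * η) := by nlinarith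
      _ ≤ 1 / 4 := by linarith
  have hval (j) : |∑ a, X j a * V a c - ∑ a, (Y j a : ℝ) * V a c| ≤ R ^ 2 * η := by
    rw [← Finset.sum_sub_distrib]
    simp only [← sub_mul]
    calc _ ≤ R * (η * R) := abs_sum_mul_le hη0.le (by linarith) hcard (hXY j) (fun a => hV a c)
      _ = R ^ 2 * η := by ring
  have hvalb (j) : |∑ a, (Y j a : ℝ) * V a c| ≤ R ^ 3 := by
    calc _ ≤ R * (R * R) := abs_sum_mul_le hR0.le (by linarith) hcard (hY j) (fun a => hV a c)
      _ = R ^ 3 := by ring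
  have hvald (j) : |∑ a, X j a * V a c - ∑ a, (Y τ a : ℝ) * V a c| ≤ 3 * R ^ 3 := by
    have h1 := hval j
    have h2 := hvalb j
    have h3 := hvalb τ
    have h4 : R ^ 2 * η ≤ R ^ 3 := by nlinarith
    rw [abs_le] at *
    constructor <;> linarith [h1.1, h1.2, h2.1, h2.2, h3.1, h3.2]
  have hdR : (1 : ℝ) ≤ d := by exact_mod_cast hd0
  have hsq : √(d : ℝ) ≤ R := by
    refine le_trans ?_ hd
    rw [Real.sqrt_le_left (by linarith)]
    nlinarith
  have hsq0 : 0 < √(d : ℝ) := Real.sqrt_pos.2 (by linarith)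
  have hatt := softmax_average_approx (s := Finset.Iic i) (τ := τ) (Finset.mem_Iic.2 hτ)
    (f := fun j => 2 ^ p * (∑ b, (∑ a, X i a * M a b) * X j b) / √(d : ℝ))
    (v := fun j => ∑ a, X j a * V a c) (g := 2 ^ p / (2 * R)) (a := R ^ 2 * η) (b := 3 * R ^ 3)
    (R := R) (t := ∑ a, (Y τ a : ℝ) * V a c) (by positivity)
    (by
      intro j hj hne
      have h1 := hmax j (Finset.mem_Iic.1 hj) hne
      have h2 : ((∑ b, (∑ a, Y i a * M a b) * Y j b : ℤ) : ℝ) + 1 ≤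
          ((∑ b, (∑ a, Y i a * M a b) * Y τ b : ℤ) : ℝ) := by exact_mod_cast h1
      have h3 := abs_le.1 (hscore j)
      have h4 := abs_le.1 (hscore τ)
      have h5 : ∑ b, (∑ a, X i a * M a b) * X j b + 1 / 2 ≤
          ∑ b, (∑ a, X i a * M a b) * X τ b := by linarith [h3.2, h4.1]
      -- The head dimension is `d`, so the usual normalisation divides the gap by `√d ≤ R`.
      have h6 : 2 ^ p / (2 * R) ≤ 2 ^ p * (1 / 2) / √(d : ℝ) := by
        rw [show 2 ^ p / (2 * R) = 2 ^ p * (1 / 2) / R by field_simp]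
        exact div_le_div_of_nonneg_left (by positivity) hsq0 hsq
      refine (add_le_add_right h6 _).trans ?_
      rw [← add_div, ← mul_add]
      gcongr)
    (hval τ) (by positivity) (fun j _ => hvald j)
    (by
      refine le_trans ?_ hL
      exact_mod_cast (Finset.card_le_univ _).trans (by simp))
  have hpre : |((sharpLayer (2 ^ p) M V A C).attention X i + X i) c - z c| ≤
      η + (R ^ 2 * η + 6 * R ^ 5 * η) := by
    have hzc : (z c : ℝ) = Y i c + ∑ a, (Y τ a : ℝ) * V a c := by
      rw [hyz c]; push_cast; rfl
    have h1 : R * (3 * R ^ 3 / (2 ^ p / (2 * R))) ≤ 6 * R ^ 5 * η := by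
      have : R * (3 * R ^ 3 / (2 ^ p / (2 * R))) = 6 * R ^ 5 * (1 / 2 ^ p) := by
        field_simp; ring
      rw [this]
      gcongr
    have h2 : ((sharpLayer (2 ^ p) M V A C).attention X i + X i) c - z c = (X i c - Y i c) +
        ((sharpLayer (2 ^ p) M V A C).attention X i c - ∑ a, (Y τ a : ℝ) * V a c) := by
      rw [hzc, Pi.add_apply]; ring
    rw [h2]
    refine (abs_add_le _ _).trans (add_le_add (hXY i c) ?_)
    rw [attention_sharpLayer]
    exact hatt.trans (by linarith)
  have htot : η + (R ^ 2 * η + 6 * R ^ 5 * η) + η ≤ R ^ 6 * η := by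
    have : η + (R ^ 2 * η + 6 * R ^ 5 * η) + η = (2 + R ^ 2 + 6 * R ^ 5) * η := by ring
    rw [this]
    exact mul_le_mul_of_nonneg_right (by nlinarith) hη0.le
  have hb : |((sharpLayer (2 ^ p) M V A C).attention X i + X i) c| ≤ B := by
    have h4 := abs_sub_abs_le_abs_sub (((sharpLayer (2 ^ p) M V A C).attention X i + X i) c) (z c)
    have : R ^ 4 ≤ 2 ^ p * R ^ 4 := le_mul_of_one_le_left (by positivity) hΛ
    nlinarith [hz c]
  have hr := hρ _ hb
  rw [Layer.attnRes]
  rw [abs_le] at *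
  constructor <;> linarith [hr.1, hr.2, hpre.1, hpre.2]

/-- Without values the attention sublayer only rounds. -/
lemma attnRes_approx_of_value_eq_zero {p : ℕ} {B R η : ℝ} {ρ : ℝ → ℝ} (hρ : IsRounding p B ρ)
    (hR : 9 ≤ R) (hB : 2 ^ p * R ^ 4 ≤ B)
    (hη : 1 / 2 ^ p ≤ η) (hη1 : R ^ 6 * η ≤ 1)
    {X : Fin L → Fin d → ℝ} {i : Fin L} {y : Fin d → ℤ} (hXY : ∀ c, |X i c - y c| ≤ η)
    (hY : ∀ c, |(y c : ℝ)| ≤ R) (c : Fin d) :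
    |(sharpLayer (2 ^ p) M 0 A C).attnRes ρ X i c - y c| ≤ R ^ 6 * η := by
  have hΛ : (1 : ℝ) ≤ 2 ^ p := one_le_pow₀ (by norm_num)
  have hδ0 : (0 : ℝ) < 1 / 2 ^ p := by positivity
  have hη0 : 0 < η := hδ0.trans_le hη
  have h6 : 9 ≤ R ^ 6 := hR.trans (le_self_pow₀ (by linarith) (by norm_num))
  have h4 : R ≤ R ^ 4 / 2 := by
    have h2 : 81 ≤ R ^ 2 := by nlinarith
    nlinarith
  have hat : ((sharpLayer (2 ^ p) M 0 A C).attention X i + X i) c = X i c := by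
    rw [Pi.add_apply, attention_sharpLayer]; simp
  have hb : |X i c| ≤ B := by
    have h4 := abs_sub_abs_le_abs_sub (X i c) (y c)
    have : R ^ 4 ≤ 2 ^ p * R ^ 4 := le_mul_of_one_le_left (by positivity) hΛ
    nlinarith [hY c, hXY c]
  have hr := hρ _ hb
  rw [Layer.attnRes, hat]
  have h1 := hXY c
  have h2 : 9 * η ≤ R ^ 6 * η := mul_le_mul_of_nonneg_right h6 hη0.le
  rw [abs_le] at *
  constructor <;> linarith [hr.1, hr.2, h1.1, h1.2]

end

/-- Integer description of a layer acting on registers indexed by `σ`: a score form `M`, a value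
map `V`, and for each register `o` four rectifiers with linear forms `A o k` whose outputs are
added to `o` with coefficients `C o k`. -/
structure Gates (σ : Type) where
  M : σ → σ → ℤ
  V : σ → σ → ℤ
  A : σ → Fin 4 → σ → ℤ
  C : σ → Fin 4 → ℤ

/-- The hidden vector that holds the register contents `x`; the other coordinates are zero. -/
def place {σ : Type} {d : ℕ} (e : σ × Fin 4 ≃ Fin d) (x : σ → ℤ) (c : Fin d) : ℤ :=
  if (e.symm c).2 = 0 then x (e.symm c).1 else 0

/-! ### Registers inside the hidden vector, and the layers acting on them. -/

section Place

variable {σ : Type} [Fintype σ] {d : ℕ} (e : σ × Fin 4 ≃ Fin d)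

omit [Fintype σ] in
lemma abs_place_le {x : σ → ℤ} {R : ℤ} (hR : 0 ≤ R) (hx : ∀ o, |x o| ≤ R) (c : Fin d) :
    |place e x c| ≤ R := by
  unfold place
  split_ifs
  · exact hx _
  · simpa using hR

/-- Each register owns four coordinates. All four index hidden units of the feed-forward network,
but only the first carries content in the residual stream, so sums over coordinates reduce to sums
over registers. -/
lemma sum_place_mul {K : Type*} [CommRing K] (x : σ → ℤ) (f : Fin d → K) :
    ∑ c, (place e x c : K) * f c = ∑ o, (x o : K) * f (e (o, 0)) := by
  rw [← e.sum_comp, Fintype.sum_prod_type]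
  refine Finset.sum_congr rfl fun o _ => ?_
  simp [place]

end Place

lemma allParams_sharpLayer {d : ℕ} {M V A C : Matrix (Fin d) (Fin d) ℤ} {R p : ℕ} {B : ℝ}
    (hM : ∀ i j, |M i j| ≤ R) (hV : ∀ i j, |V i j| ≤ R) (hA : ∀ i j, |A i j| ≤ R)
    (hC : ∀ i j, |C i j| ≤ R) (hB : 2 ^ p * R ≤ B) (hB1 : 1 ≤ B) :
    (sharpLayer (2 ^ p) M V A C).AllParams (FixedPoint p B) := by
  have hΛ : (1 : ℝ) ≤ 2 ^ p := one_le_pow₀ (by norm_num)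
  have hΛ0 : (0 : ℝ) < 2 ^ p := by positivity
  have hRR : (R : ℝ) ≤ 2 ^ p * R := le_mul_of_one_le_left (by positivity) hΛ
  have cast {z : ℤ} (hz : |z| ≤ R) : |(z : ℝ)| ≤ R := by exact_mod_cast hz
  have big {z : ℤ} (hz : |z| ≤ R) : FixedPoint p B (2 ^ p * (z : ℝ)) := by
    refine ⟨?_, z * 2 ^ p * 2 ^ p, by push_cast; field_simp⟩
    rw [abs_mul, abs_of_pos hΛ0]
    exact (mul_le_mul_of_nonneg_left (cast hz) hΛ0.le).trans hB
  have mid {z : ℤ} (hz : |z| ≤ R) : FixedPoint p B (z : ℝ) :=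
    ⟨((cast hz).trans hRR).trans hB, z * 2 ^ p, by push_cast; field_simp⟩
  -- The output weights `z / 2 ^ p` use the full resolution: they are exactly on the fixed-point
  -- grid.
  have small {z : ℤ} (hz : |z| ≤ R) : FixedPoint p B ((z : ℝ) / 2 ^ p) := by
    refine ⟨?_, z, rfl⟩
    rw [abs_div, abs_of_pos hΛ0]
    exact (((div_le_self (abs_nonneg _) hΛ).trans (cast hz)).trans hRR).trans hB
  have zero : FixedPoint p B 0 := ⟨by simpa using (zero_le_one.trans hB1), 0, by simp⟩
  have unit (i j : Fin d) : FixedPoint p B ((1 : Matrix (Fin d) (Fin d) ℝ) i j) := by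
    rw [Matrix.one_apply]
    split_ifs
    · exact ⟨by simpa using hB1, 2 ^ p, by push_cast; field_simp⟩
    · exact zero
  exact ⟨fun _ i j => big (hM i j), fun _ i j => unit i j, fun _ i j => mid (hV i j),
    fun _ i j => unit i j, fun i j => big (hA i j), fun _ => zero, fun i j => small (hC i j)⟩

namespace Gates

variable {σ : Type} [Fintype σ] [DecidableEq σ] {d L : ℕ} (e : σ × Fin 4 ≃ Fin d) (D : Gates σ)

/-- The score of the key `y` for the query `x`. -/
def score (x y : σ → ℤ) : ℤ := ∑ b, (∑ a, x a * D.M a b) * y b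

/-- The exact effect of the rectifiers. -/
def rect (x : σ → ℤ) (o : σ) : ℤ := ∑ k, max 0 (∑ a, x a * D.A o k a) * D.C o k

/-- All entries are at most `R` in absolute value. -/
def Bounded (R : ℤ) : Prop :=
  (∀ a b, |D.M a b| ≤ R) ∧ (∀ a b, |D.V a b| ≤ R) ∧ (∀ o k a, |D.A o k a| ≤ R) ∧
  ∀ o k, |D.C o k| ≤ R

/-- The layer maps the exact register contents `X` to `Y`, either by its rectifiers or by fetching
values from the positions with strictly largest score. -/
def Step (X Y : Fin L → σ → ℤ) : Prop :=
  (D.V = 0 ∧ ∀ i o, Y i o = X i o + D.rect (X i) o) ∨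
  (D.C = 0 ∧ ∃ τ : Fin L → Fin L, ∀ i, τ i ≤ i ∧
    (∀ j ≤ i, j ≠ τ i → D.score (X i) (X j) < D.score (X i) (X (τ i))) ∧
    ∀ o, Y i o = X i o + ∑ a, X (τ i) a * D.V a o)

/-- The Transformer layer with scaling factor `Λ` described by `D`. -/
noncomputable def toLayer (Λ : ℝ) : Layer d :=
  sharpLayer Λ
    (Matrix.of fun c c' => D.M (e.symm c).1 (e.symm c').1)
    (Matrix.of fun c c' => place e (D.V (e.symm c).1) c')
    (Matrix.of fun c u => D.A (e.symm u).1 (e.symm u).2 (e.symm c).1)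
    (Matrix.of fun u c =>
      place e (fun o => if (e.symm u).1 = o then D.C o (e.symm u).2 else 0) c)

variable {e D}

omit [Fintype σ] in
lemma allParams_toLayer {R : ℕ} (hD : D.Bounded R) {p : ℕ} {B : ℝ} (hB : 2 ^ p * R ≤ B)
    (hB1 : 1 ≤ B) : (D.toLayer e (2 ^ p)).AllParams (FixedPoint p B) := by
  obtain ⟨hM, hV, hA, hC⟩ := hD
  have hR0 : (0 : ℤ) ≤ R := by positivity
  have hC' (u : Fin d) (o : σ) :
      |if (e.symm u).1 = o then D.C o (e.symm u).2 else 0| ≤ (R : ℤ) := by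
    split_ifs
    · exact hC _ _
    · simp
  unfold toLayer
  apply allParams_sharpLayer (R := R) (hB := hB) (hB1 := hB1)
  · intro i j
    exact hM (e.symm i).1 (e.symm j).1
  · intro i j
    exact abs_place_le e hR0 (hV (e.symm i).1) j
  · intro i j
    exact hA (e.symm j).1 (e.symm j).2 (e.symm i).1
  · intro i j
    exact abs_place_le e hR0 (hC' i) j

omit [DecidableEq σ] in
lemma sum_place_score (x y : σ → ℤ) :
    ∑ c', (∑ c, place e x c * D.M (e.symm c).1 (e.symm c').1) * place e y c' = D.score x y := by
  have h1 (c') : ∑ c, place e x c * D.M (e.symm c).1 (e.symm c').1 =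
      ∑ a, x a * D.M a (e.symm c').1 := by
    simpa using sum_place_mul (K := ℤ) e x fun c => D.M (e.symm c).1 (e.symm c').1
  simp only [h1]
  simp only [mul_comm _ (place e y _)]
  have h2 := sum_place_mul (K := ℤ) e y fun c' => ∑ a, x a * D.M a (e.symm c').1
  simp only [Int.cast_id, Equiv.symm_apply_apply] at h2
  rw [h2, score]
  exact Finset.sum_congr rfl fun b _ => mul_comm _ _

lemma sum_place_rect (x : σ → ℤ) (c : Fin d) :
    ∑ u, max 0 (∑ c', place e x c' * D.A (e.symm u).1 (e.symm u).2 (e.symm c').1) *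
      place e (fun o => if (e.symm u).1 = o then D.C o (e.symm u).2 else 0) c =
    place e (D.rect x) c := by
  have h1 (u) : ∑ c', place e x c' * D.A (e.symm u).1 (e.symm u).2 (e.symm c').1 =
      ∑ a, x a * D.A (e.symm u).1 (e.symm u).2 a := by
    simpa using sum_place_mul (K := ℤ) e x fun c' => D.A (e.symm u).1 (e.symm u).2 (e.symm c').1
  simp only [h1]
  rw [← e.sum_comp, Fintype.sum_prod_type]
  simp only [Equiv.symm_apply_apply, place, rect]
  split_ifs
  · rw [Finset.sum_eq_single (e.symm c).1]
    · simp
    · intro b _ hb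
      simp [hb]
    · simp
  · simp

omit [DecidableEq σ] in
lemma sum_place_value (x : σ → ℤ) (c : Fin d) :
    ∑ c', place e x c' * place e (D.V (e.symm c').1) c =
    place e (fun o => ∑ a, x a * D.V a o) c := by
  have h2 := sum_place_mul (K := ℤ) e x fun c' => place e (D.V (e.symm c').1) c
  simp only [Int.cast_id, Equiv.symm_apply_apply] at h2
  rw [h2]
  unfold place
  split_ifs <;> simp

omit [Fintype σ] [DecidableEq σ] in
lemma place_add (x y : σ → ℤ) (c : Fin d) :
    place e (fun o => x o + y o) c = place e x c + place e y c := by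
  unfold place
  split_ifs <;> simp

/-- The actual layer follows the exact one up to a polynomial loss of precision. -/
lemma apply_approx {p R : ℕ} {B η : ℝ} {ρ : ℝ → ℝ} (hρ : IsRounding p B ρ) (hR : 9 ≤ R)
    (hd : d ≤ R) (hd0 : 0 < d) (hL : L ≤ R) (hB : 2 ^ p * (R : ℝ) ^ 4 ≤ B)
    (hη : 1 / 2 ^ p ≤ η) (hη1 : (R : ℝ) ^ 11 * η ≤ 1) (hD : D.Bounded R)
    {X Y : Fin L → σ → ℤ} (hXY : D.Step X Y) (hX : ∀ i o, |X i o| ≤ R) (hY : ∀ i o, |Y i o| ≤ R)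
    {Z : Fin L → Fin d → ℝ} (hZ : ∀ i c, |Z i c - place e (X i) c| ≤ η) (i : Fin L) (c : Fin d) :
    |(D.toLayer e (2 ^ p)).apply ρ Z i c - place e (Y i) c| ≤ (R : ℝ) ^ 11 * η := by
  obtain ⟨hM, hV, hA, hC⟩ := hD
  have hR0 : (0 : ℤ) ≤ R := by positivity
  have hR' : (9 : ℝ) ≤ R := by exact_mod_cast hR
  have hδ0 : (0 : ℝ) < 1 / 2 ^ p := by positivity
  have hη0 : 0 < η := hδ0.trans_le hη
  have cast {z : ℤ} (hz : |z| ≤ R) : |(z : ℝ)| ≤ (R : ℝ) := by exact_mod_cast hz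
  have h6 : (1 : ℝ) ≤ (R : ℝ) ^ 6 := one_le_pow₀ (by linarith)
  -- The attention sublayer loses a factor `R ^ 6`, the feed-forward sublayer another `R ^ 5`.
  have h65 : (R : ℝ) ^ 11 * η = R ^ 5 * (R ^ 6 * η) := by ring
  have hη6 : (R : ℝ) ^ 6 * η ≤ 1 := by
    refine le_trans ?_ hη1
    rw [h65]
    exact le_mul_of_one_le_left (by positivity) (one_le_pow₀ (by linarith))
  have hCb (u c) : |((place e (fun o => if (e.symm u).1 = o then D.C o (e.symm u).2 else 0) c : ℤ)
      : ℝ)| ≤ R := by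
    refine cast (abs_place_le e hR0 (fun o => ?_) c)
    split_ifs
    · exact hC _ _
    · simp
  have ffn {x : σ → ℤ} (hx : ∀ o, |x o| ≤ R) (hxY : ∀ o, Y i o = x o + D.rect x o)
      (hh : ∀ c, |(D.toLayer e (2 ^ p)).attnRes ρ Z i c - place e x c| ≤ (R : ℝ) ^ 6 * η) :
      |(D.toLayer e (2 ^ p)).apply ρ Z i c - place e (Y i) c| ≤ (R : ℝ) ^ 11 * η := by
    rw [h65]
    refine ffn_approx hρ hR' (by exact_mod_cast hd) hB (hη.trans (le_mul_of_one_le_left hη0.le h6))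
      (h65 ▸ hη1) (fun a u => cast (hA _ _ _)) hCb hh
      (fun c => cast (abs_place_le e hR0 hx c)) (fun c => cast (abs_place_le e hR0 (hY i) c))
      (fun c => ?_) c
    rw [funext hxY, place_add]
    congr 1
    exact (sum_place_rect x c).symm
  -- In either case the other sublayer acts as the identity up to rounding and approximation error:
  -- zero values make attention vanish whatever its weights, zero coefficients silence the
  -- rectifiers.
  rcases hXY with ⟨hV0, hstep⟩ | ⟨hC0, τ, hstep⟩
  · refine ffn (hX i) (hstep i) fun c => ?_
    have hl : D.toLayer e (2 ^ p) = sharpLayer (2 ^ p)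
      (Matrix.of fun c c' => D.M (e.symm c).1 (e.symm c').1) 0
      (Matrix.of fun c u => D.A (e.symm u).1 (e.symm u).2 (e.symm c).1)
      (Matrix.of fun u c =>
        place e (fun o => if (e.symm u).1 = o then D.C o (e.symm u).2 else 0) c) := by
      rw [toLayer]
      congr 1
      ext c c'
      simp [hV0, place]
    rw [hl]
    exact attnRes_approx_of_value_eq_zero hρ hR' hB hη hη6 (hZ i)
      (fun c => cast (abs_place_le e hR0 (hX i) c)) c
  · refine ffn (hY i) (fun o => by simp [rect, hC0]) fun c => ?_
    obtain ⟨hτ, hmax, hval⟩ := hstep i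
    refine attnRes_approx hρ hR' (by exact_mod_cast hd) hd0 (by exact_mod_cast hL) hB hη hη6
      (fun a u => cast (hM _ _)) (fun a u => cast (abs_place_le e hR0 (hV _) _)) hZ
      (fun i c => cast (abs_place_le e hR0 (hX i) c)) hτ (fun j hj hne => ?_)
      (fun c => cast (abs_place_le e hR0 (hY i) c)) (fun c => ?_) c
    · simp only [sum_place_score]
      exact hmax j hj hne
    · rw [funext hval, place_add]
      congr 1
      exact (sum_place_value (X (τ i)) c).symm

/-- A stack of layers follows the exact computation. -/
lemma foldl_approx {p R K : ℕ} {B : ℝ} {ρ : ℝ → ℝ} (hρ : IsRounding p B ρ) (hR : 9 ≤ R)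
    (hd : d ≤ R) (hd0 : 0 < d) (hL : L ≤ R) (hB : 2 ^ p * (R : ℝ) ^ 4 ≤ B)
    (hp : (R : ℝ) ^ (11 * K) * (1 / 2 ^ p) ≤ 1) {D : ℕ → Gates σ} (hD : ∀ l < K, (D l).Bounded R)
    {X : ℕ → Fin L → σ → ℤ} (hX : ∀ l < K, (D l).Step (X l) (X (l + 1)))
    (hXR : ∀ l ≤ K, ∀ i o, |X l i o| ≤ R)
    {Z : Fin L → Fin d → ℝ} (hZ : ∀ i c, Z i c = place e (X 0 i) c) (i : Fin L) (c : Fin d) :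
    |((List.range K).map fun l => (D l).toLayer e (2 ^ p)).foldl
      (fun Z lay => lay.apply ρ Z) Z i c - place e (X K i) c| ≤
      (R : ℝ) ^ (11 * K) * (1 / 2 ^ p) := by
  have hR' : (9 : ℝ) ≤ R := by exact_mod_cast hR
  induction K generalizing i c with
  | zero => simp [hZ]
  | succ K ih =>
    have hpow : (R : ℝ) ^ (11 * (K + 1)) * (1 / 2 ^ p) =
        R ^ 11 * (R ^ (11 * K) * (1 / 2 ^ p)) := by ring
    have hle : (1 : ℝ) / 2 ^ p ≤ R ^ (11 * K) * (1 / 2 ^ p) :=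
      le_mul_of_one_le_left (by positivity) (one_le_pow₀ (by linarith))
    have hp' : (R : ℝ) ^ (11 * K) * (1 / 2 ^ p) ≤ 1 := by
      refine le_trans ?_ hp
      rw [hpow]
      exact le_mul_of_one_le_left (by positivity) (one_le_pow₀ (by linarith))
    have ih' := ih hp' (fun l hl => hD l (by omega)) (fun l hl => hX l (by omega))
      (fun l hl => hXR l (by omega))
    rw [List.range_succ, List.map_append, List.foldl_append, hpow]
    exact apply_approx hρ hR hd hd0 hL hB hle (hpow ▸ hp) (hD K (by omega)) (hX K (by omega))
      (hXR K (by omega)) (hXR (K + 1) (by omega)) ih' i c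

end Gates

/-! ## Registers -/

/-- The registers: the `w + 2` input coordinates (bits, position, constant one) and twelve arrays
of working registers. -/
abbrev Reg (n N w : ℕ) : Type := Fin (w + 2) ⊕ Fin 12 × Fin (n + N + w + 2)

/-- The hidden dimension. -/
abbrev hiddenDim (n N w : ℕ) : ℕ := 4 * (w + 2 + 12 * (n + N + w + 2))

/-- The numbering of registers and hidden units; the input coordinates come first. -/
def regEquiv (n N w : ℕ) : Reg n N w × Fin 4 ≃ Fin (hiddenDim n N w) :=
  (Equiv.prodComm _ _).trans
    (((Equiv.refl _).prodCongr
      (((Equiv.refl _).sumCongr finProdFinEquiv).trans finSumFinEquiv)).trans finProdFinEquiv)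

/-- The prescribed input format fixes the first `w + 2` coordinates; the numbering must respect
this. -/
lemma regEquiv_inl {n N w : ℕ} (c : Fin (w + 2)) :
    (regEquiv n N w (Sum.inl c, 0) : ℕ) = c := by
  simp [regEquiv, finProdFinEquiv]

section Forms

variable {n N w : ℕ}

/-- The linear form reading input coordinate `c`, with coefficient `z`. -/
def inForm (c : ℕ) (z : ℤ) : Reg n N w → ℤ
  | .inl c' => if (c' : ℕ) = c then z else 0
  | .inr _ => 0

/-- The linear form on the `k`-th array with coefficients `f`. -/
def regForm (k : Fin 12) (f : ℕ → ℤ) : Reg n N w → ℤ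
  | .inl _ => 0
  | .inr (k', s) => if k' = k then f s else 0

/-- The linear form reading entry `i` of the `k`-th array. -/
def rd (k : Fin 12) (i : ℕ) : Reg n N w → ℤ :=
  regForm k fun s => if s = i then 1 else 0

/-- The constant form. -/
def constForm (z : ℤ) : Reg n N w → ℤ := inForm (w + 1) z

lemma dotProduct_inForm (x : Reg n N w → ℤ) {c : ℕ} (hc : c < w + 2) (z : ℤ) :
    x ⬝ᵥ inForm c z = x (.inl ⟨c, hc⟩) * z := by
  rw [dotProduct, Fintype.sum_sum_type, Finset.sum_eq_single ⟨c, hc⟩]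
  · simp [inForm]
  · intro b _ hb
    have : (b : ℕ) ≠ c := fun h => hb (Fin.ext h)
    simp [inForm, this]
  · simp

lemma dotProduct_regForm (x : Reg n N w → ℤ) (k : Fin 12) (f : ℕ → ℤ) :
    x ⬝ᵥ regForm k f = ∑ s, x (.inr (k, s)) * f s := by
  rw [dotProduct, Fintype.sum_sum_type, Fintype.sum_prod_type, Finset.sum_eq_single k]
  · simp [regForm]
  · intro b _ hb
    simp [regForm, hb]
  · simp

lemma abs_inForm_le (c : ℕ) (z : ℤ) (a : Reg n N w) : |inForm c z a| ≤ |z| := by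
  unfold inForm
  split
  · split_ifs <;> simp
  · simp

lemma abs_regForm_le {k : Fin 12} {f : ℕ → ℤ} {b : ℤ} (hb : 0 ≤ b)
    (hf : ∀ s < n + N + w + 2, |f s| ≤ b) (a : Reg n N w) : |regForm k f a| ≤ b := by
  unfold regForm
  split
  · simpa using hb
  · split_ifs
    · exact hf _ (Fin.is_lt _)
    · simpa using hb

lemma abs_rd_le (k : Fin 12) (i : ℕ) (a : Reg n N w) : |rd k i a| ≤ 1 :=
  abs_regForm_le zero_le_one (fun s _ => by split_ifs <;> simp) a

end Forms

/-! ## The exact computation -/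

namespace MTParams

variable {w : ℕ} (P : MTParams w)

/-- The new word computed from the words at indices `i`, `i + 1` and `i + m`. -/
def twist (x y z : BitVec w) : BitVec w :=
  let t := (x &&& P.upper) ||| (y &&& P.lower)
  z ^^^ (t >>> 1) ^^^ (if t.getLsbD 0 then P.a else 0#w)

end MTParams

/-- A bit of a word as an integer. -/
def ibit {w : ℕ} (v : BitVec w) (s : ℕ) : ℤ := if v.getLsbD s then 1 else 0

/-- The word of a token; the separator counts as zero. -/
def word {w : ℕ} (t : Token w) : BitVec w := t.getD 0#w

/-- The block of the sequence that contains index `i`; blocks start with a separator. -/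
def grp (n i : ℕ) : ℕ := (i + 2) / (n + 2)

/-- The place of index `i` in its block. -/
def off (n i : ℕ) : ℕ := (i + 2) % (n + 2)

/-- The place of the state word with index `g - 1 + s` (cyclically). -/
def fetchOff (n s g : ℕ) : ℕ := if g = 0 then 2 else 2 + (g - 1 + s) % n

/-- The index of that state word in the preceding block. -/
def fetchSrc (n s i : ℕ) : ℕ := (grp n i - 1) * (n + 2) + fetchOff n s (grp n i) - 2

/-- The place of the token to be copied at place `r`. -/
def copyOff (n r : ℕ) : ℕ := if r = 0 then 2 else if r = n + 1 then n + 1 else r + 1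

/-- The index of the token to be copied, in the preceding block. -/
def copySrc (n i : ℕ) : ℕ :=
  if grp n i = 0 then i else (grp n i - 1) * (n + 2) + copyOff n (off n i) - 2

/-! ### Decomposition of indices into block and place. -/

section Positions

variable {n : ℕ}

lemma off_lt (i : ℕ) : off n i < n + 2 := Nat.mod_lt _ (by omega)

lemma grp_mul_add_off (i : ℕ) : grp n i * (n + 2) + off n i = i + 2 := by
  rw [grp, off, mul_comm]; exact Nat.div_add_mod _ _

/-- The shift by 2 treats the prompt as block 0 with its places 0 and 1 (separator and output)
missing. Every later block has a separator at place 0, an output at place 1 and the state at places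
2 to `n + 1`. -/
lemma grp_off_unique {i g r : ℕ} (hr : r < n + 2) (h : g * (n + 2) + r = i + 2) :
    grp n i = g ∧ off n i = r := by
  rw [grp, off, ← h, add_comm, Nat.add_mul_div_right _ _ (by omega), Nat.add_mul_mod_self_right,
    Nat.div_eq_of_lt hr, Nat.mod_eq_of_lt hr]
  simp

lemma grp_mono {i j : ℕ} (h : i ≤ j) : grp n i ≤ grp n j := Nat.div_le_div_right (by omega)

lemma eq_of_grp_off {i j : ℕ} (hg : grp n i = grp n j) (ho : off n i = off n j) : i = j := by
  have h1 := grp_mul_add_off (n := n) i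
  have h2 := grp_mul_add_off (n := n) j
  rw [hg, ho] at h1
  omega

lemma lt_of_grp_lt {i j : ℕ} (h : grp n i < grp n j) : i < j := by
  by_contra hc
  have := grp_mono (n := n) (not_lt.1 hc)
  omega

lemma fetchOff_mem [NeZero n] (s g : ℕ) : 2 ≤ fetchOff n s g ∧ fetchOff n s g < n + 2 := by
  have := Nat.mod_lt (g - 1 + s) (Nat.pos_of_neZero n)
  have := Nat.pos_of_neZero n
  unfold fetchOff
  split_ifs <;> omega

lemma grp_off_fetchSrc [NeZero n] (s i : ℕ) :
    grp n (fetchSrc n s i) = grp n i - 1 ∧ off n (fetchSrc n s i) = fetchOff n s (grp n i) := by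
  have h := fetchOff_mem (n := n) s (grp n i)
  refine grp_off_unique h.2 ?_
  rw [fetchSrc]
  omega

/-- Causality: the source lies in an earlier block. In block 0 the default place 2 makes it index 0.
-/
lemma fetchSrc_le [NeZero n] (s i : ℕ) : fetchSrc n s i ≤ i := by
  rcases Nat.eq_zero_or_pos (grp n i) with h | h
  · simp [fetchSrc, fetchOff, h]
  · exact (lt_of_grp_lt (n := n) (by have := (grp_off_fetchSrc (n := n) s i).1; omega)).le

lemma copyOff_mem [NeZero n] {r : ℕ} (hr : r < n + 2) :
    2 ≤ copyOff n r ∧ copyOff n r < n + 2 := by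
  have := Nat.pos_of_neZero n
  unfold copyOff
  split_ifs <;> omega

lemma grp_off_copySrc [NeZero n] {i : ℕ} (hi : grp n i ≠ 0) :
    grp n (copySrc n i) = grp n i - 1 ∧ off n (copySrc n i) = copyOff n (off n i) := by
  have h := copyOff_mem (n := n) (off_lt i)
  refine grp_off_unique h.2 ?_
  rw [copySrc, if_neg hi]
  omega

/-- Block 0 has no predecessor, so there each index is its own source. -/
lemma copySrc_le [NeZero n] (i : ℕ) : copySrc n i ≤ i := by
  by_cases h : grp n i = 0
  · simp [copySrc, h]
  · exact (lt_of_grp_lt (n := n) (by have := (grp_off_copySrc (n := n) h).1; omega)).le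

end Positions

section Exact

variable {w : ℕ} (n N : ℕ) (P : MTParams w) (tok : ℕ → Token w)

/-- The new state word computed at index `i`. -/
def newWord (i : ℕ) : BitVec w :=
  P.twist (word (tok (fetchSrc n 0 i))) (word (tok (fetchSrc n 1 i)))
    (word (tok (fetchSrc n P.m i)))

/-- The word after the first three tempering steps, one by one. -/
def temper₁ (z : BitVec w) : BitVec w := z ^^^ (z >>> P.u)
def temper₂ (z : BitVec w) : BitVec w := temper₁ P z ^^^ ((temper₁ P z <<< P.s) &&& P.b)
def temper₃ (z : BitVec w) : BitVec w := temper₂ P z ^^^ ((temper₂ P z <<< P.t) &&& P.c)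

/-- The word predicted at index `i`. -/
def outWord (i : ℕ) : BitVec w :=
  if off n i = 0 then P.temper (newWord n P tok i)
  else if off n i = 1 + (grp n i - 1) % n then newWord n P tok i
  -- Here the next token is the separator, whose binary representation is zero.
  else if off n i = n + 1 then 0#w
  else word (tok (copySrc n i))

/-- The final content of the `k`-th array at index `i` of the sequence. -/
def content (k : Fin 12) (i s : ℕ) : ℤ :=
  match k with
  | 0 => if s = grp n i then 1 else 0
  | 1 => if s = off n i then 1 else 0
  | 2 => ibit (word (tok (fetchSrc n 0 i))) s
  | 3 => ibit (word (tok (fetchSrc n 1 i))) s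
  | 4 => ibit (word (tok (fetchSrc n P.m i))) s
  | 5 => ibit (word (tok (copySrc n i))) s
  | 6 => ibit (newWord n P tok i) s
  | 7 => ibit (temper₁ P (newWord n P tok i)) s
  | 8 => ibit (temper₂ P (newWord n P tok i)) s
  | 9 => ibit (temper₃ P (newWord n P tok i)) s
  | 10 => ibit (P.temper (newWord n P tok i)) s
  | 11 => if off n i = 1 + (grp n i - 1) % n then 1 else 0

/-- The register contents at index `i` before layer `l`. -/
def regs (l i : ℕ) : Reg n N w → ℤ
  | .inl c =>
    if (c : ℕ) < w then
      -- The input bits stay readable until all fetches are done; layer 12 replaces them by the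
      -- prediction.
      (if l ≤ 12 then ibit (word (tok i)) c else ibit (outWord n P tok i) c)
    else if (c : ℕ) = w then i + 1 else 1
  | .inr (k, s) => if (k : ℕ) < l then content n P tok k i s else 0

end Exact

/-! ## The layers -/

section Layers

variable {n N w : ℕ}

/-- A layer computing the `k`-th array by rectifiers. -/
def writeGates (k : Fin 12) (F : ℕ → Fin 4 → Reg n N w → ℤ) (G : Fin 4 → ℤ) :
    Gates (Reg n N w) where
  M := 0
  V := 0
  A o j := match o with
    | .inl _ => 0
    | .inr (k', s) => if k' = k then F s j else 0
  C o j := match o with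
    | .inl _ => 0
    | .inr (k', _) => if k' = k then G j else 0

/-- A layer fetching a word into the `k`-th array; the scores are given by tables on pairs
(block, block), (block, place) and (place, place). -/
def fetchGates (k : Fin 12) (t₁ t₂ t₃ : ℕ → ℕ → ℤ) : Gates (Reg n N w) where
  M a b := match b with
    | .inl _ => 0
    | .inr (k', s) =>
      if k' = 0 then regForm 0 (fun g => t₁ g s) a
      else if k' = 1 then (regForm 0 (fun g => t₂ g s) + regForm 1 (fun r => t₃ r s) : Reg n N w → ℤ) a
      else 0
  V a b := match b with
    | .inl _ => 0
    | .inr (k', s) => if k' = k ∧ (s : ℕ) < w then inForm s 1 a else 0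
  A := 0
  C := 0

/-- The layer that replaces the input bits. -/
def replaceGates (F : ℕ → Fin 4 → Reg n N w → ℤ) (G : Fin 4 → ℤ) : Gates (Reg n N w) where
  M := 0
  V := 0
  A o j := match o with
    | .inl c => F c j
    | .inr _ => 0
  C o j := match o with
    | .inl c => if (c : ℕ) < w then G j else 0
    | .inr _ => 0

/-- Rectifier forms and coefficients for the parity of a form with values in `0, …, 3`. -/
def parityForms (f : Reg n N w → ℤ) : Fin 4 → Reg n N w → ℤ :=
  ![f, f - constForm 1, f - constForm 2, 0]

/-- Rectifier forms for the indicator of the zero set of an integer form. -/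
def bumpForms (f : Reg n N w → ℤ) : Fin 4 → Reg n N w → ℤ :=
  ![f + constForm 1, f, f - constForm 1, 0]

variable (P : MTParams w)

/-- The twisted word in terms of the fetched words. -/
def mixForm (s : ℕ) : Reg n N w → ℤ := if P.upper.getLsbD s then rd 2 s else rd 3 s

def shiftRightForm (k : Fin 12) (u s : ℕ) : Reg n N w → ℤ := rd k s + rd k (u + s)

/-- Shift and mask are constants of the generator, so they only decide which register is read and
need no gate of their own. -/
def shiftLeftForm (k : Fin 12) (u : ℕ) (b : BitVec w) (s : ℕ) : Reg n N w → ℤ :=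
  rd k s + if u ≤ s ∧ b.getLsbD s then rd k (s - u) else 0

/-- The layers of the Transformer. -/
def mtGates (n N : ℕ) (l : ℕ) : Gates (Reg n N w) :=
  match l with
  -- With `a = i + 2 - s * (n + 2)`, the difference `max 0 (a + 1) - max 0 a` is the indicator of `a
  -- ≥ 0`. Subtracting the same expression for `s + 1` leaves the indicator of block `s`. Position
  -- `i + 1` supplies the missing unit in the constants.
  | 0 => writeGates 0 (fun s =>
      ![inForm w 1 + constForm (2 - s * (n + 2)), inForm w 1 + constForm (1 - s * (n + 2)),
        inForm w 1 + constForm (2 - (s + 1) * (n + 2)),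
        inForm w 1 + constForm (1 - (s + 1) * (n + 2))]) ![1, -1, -1, 1]
  -- The form has the value `off n i - s`.
  | 1 => writeGates 1 (fun s => bumpForms
      (inForm w 1 + constForm (1 - s) - regForm 0 (fun g => g * (n + 2)))) ![1, -2, 1, 0]
  -- One point for the right block and one for the right place. In block 0 the truncated `g - 1`
  -- points to block 0 itself; no prediction is required there.
  | 2 => fetchGates 2 (fun g b => if b = g - 1 then 1 else 0)
      (fun g b => if b = fetchOff n 0 g then 1 else 0) 0
  | 3 => fetchGates 3 (fun g b => if b = g - 1 then 1 else 0)
      (fun g b => if b = fetchOff n 1 g then 1 else 0) 0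
  | 4 => fetchGates 4 (fun g b => if b = g - 1 then 1 else 0)
      (fun g b => if b = fetchOff n P.m g then 1 else 0) 0
  | 5 => fetchGates 5 (fun g b => if b = g - 1 then 3 else 0) 0
      (fun r b => (if b = copyOff n r then 2 else 0) + if b = r then 1 else 0)
  -- Bit `s` of `t >>> 1` is bit `s + 1` of `t`, and bit 0 of `t` switches `a` on; the sum of the
  -- three bits is at most 3.
  | 6 => writeGates 6 (fun s => parityForms (rd 4 s + mixForm P (s + 1) +
      if P.a.getLsbD s then mixForm P 0 else 0)) ![1, -2, 2, 0]
  | 7 => writeGates 7 (fun s => parityForms (shiftRightForm 6 P.u s)) ![1, -2, 2, 0]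
  | 8 => writeGates 8 (fun s => parityForms (shiftLeftForm 7 P.s P.b s)) ![1, -2, 2, 0]
  | 9 => writeGates 9 (fun s => parityForms (shiftLeftForm 8 P.t P.c s)) ![1, -2, 2, 0]
  | 10 => writeGates 10 (fun s => parityForms (shiftRightForm 9 P.l s)) ![1, -2, 2, 0]
  | 11 => writeGates 11 (fun _ => bumpForms
      (regForm 1 (fun r => r) - constForm 1 - regForm 0 (fun g => ((g - 1) % n : ℕ))))
      ![1, -2, 1, 0]
  -- For bits, `max 0 (x + g - 1)` is `x` gated by `g`, and subtracting three mutually exclusive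
  -- indicators keeps the copied bit only when none holds. The last rectifier erases the old bit
  -- from the residual stream.
  | 12 => replaceGates (fun c =>
      ![rd 10 c + rd 1 0 - constForm 1, rd 6 c + rd 11 0 - constForm 1,
        rd 5 c - rd 1 0 - rd 11 0 - rd 1 (n + 1), inForm c 1]) ![1, 1, 1, -1]
  | _ => ⟨0, 0, 0, 0⟩

end Layers

/-! ### Reading registers, and the two generic kinds of layer. -/

section Steps

variable {n N w L : ℕ} {P : MTParams w} {tok : ℕ → Token w}

lemma ibit_eq_zero {v : BitVec w} {s : ℕ} (h : w ≤ s) : ibit v s = 0 := by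
  simp [ibit, BitVec.getLsbD_of_ge v s h]

lemma regs_dotProduct_const (l i : ℕ) (z : ℤ) : regs n N P tok l i ⬝ᵥ constForm z = z := by
  rw [constForm, dotProduct_inForm _ (by omega)]
  simp [regs]

lemma regs_dotProduct_pos (l i : ℕ) : regs n N P tok l i ⬝ᵥ inForm w 1 = i + 1 := by
  rw [dotProduct_inForm _ (by omega)]
  simp [regs]

lemma regs_dotProduct_regForm {l : ℕ} {k : Fin 12} (hk : (k : ℕ) < l) (i : ℕ) (f : ℕ → ℤ) :
    regs n N P tok l i ⬝ᵥ regForm k f =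
      ∑ s : Fin (n + N + w + 2), content n P tok k i s * f s := by
  rw [dotProduct_regForm]
  simp [regs, hk]

lemma regs_dotProduct_rd {l : ℕ} {k : Fin 12} (hk : (k : ℕ) < l) (i s : ℕ) :
    regs n N P tok l i ⬝ᵥ rd k s = if s < n + N + w + 2 then content n P tok k i s else 0 := by
  rw [rd, regs_dotProduct_regForm hk]
  split_ifs with h
  · rw [Finset.sum_eq_single ⟨s, h⟩]
    · simp
    · intro b _ hb
      have : (b : ℕ) ≠ s := fun h => hb (Fin.ext h)
      simp [this]
    · simp
  · refine Finset.sum_eq_zero fun b _ => ?_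
    have : (b : ℕ) ≠ s := by omega
    simp [this]

/-- Reading beyond the array gives zero, as does a bit beyond the word length. Hence shifts need no
upper bound. -/
lemma regs_dotProduct_rd_ibit {l : ℕ} {k : Fin 12} (hk : (k : ℕ) < l) {i : ℕ} {v : BitVec w}
    (hv : ∀ s, content n P tok k i s = ibit v s) (s : ℕ) :
    regs n N P tok l i ⬝ᵥ rd k s = ibit v s := by
  rw [regs_dotProduct_rd hk, hv]
  split_ifs with h
  · rfl
  · exact (ibit_eq_zero (by omega)).symm

lemma sum_indicator {S : ℕ} {g : ℕ} (hg : g < S) (f : ℕ → ℤ) :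
    ∑ s : Fin S, (if (s : ℕ) = g then 1 else 0) * f s = f g := by
  rw [Finset.sum_eq_single ⟨g, hg⟩]
  · simp
  · intro b _ hb
    have : (b : ℕ) ≠ g := fun h => hb (Fin.ext h)
    simp [this]
  · simp

lemma regs_dotProduct_grp {l : ℕ} (hl : 0 < l) {i : ℕ} (hi : grp n i ≤ N) (f : ℕ → ℤ) :
    regs n N P tok l i ⬝ᵥ regForm 0 f = f (grp n i) := by
  rw [regs_dotProduct_regForm (by simpa using hl)]
  exact sum_indicator (by omega) f

lemma regs_dotProduct_off {l : ℕ} (hl : 1 < l) (i : ℕ) (f : ℕ → ℤ) :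
    regs n N P tok l i ⬝ᵥ regForm 1 f = f (off n i) := by
  rw [regs_dotProduct_regForm (by simpa using hl)]
  exact sum_indicator (by have := off_lt (n := n) i; omega) f

lemma step_writeGates {l : ℕ} {k : Fin 12} (hk : (k : ℕ) = l)
    {F : ℕ → Fin 4 → Reg n N w → ℤ} {G : Fin 4 → ℤ}
    (h : ∀ i < L, ∀ s, ∑ j, max 0 (regs n N P tok l i ⬝ᵥ F s j) * G j = content n P tok k i s) :
    (writeGates k F G).Step (fun i : Fin L => regs n N P tok l i)
      (fun i : Fin L => regs n N P tok (l + 1) i) := by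
  refine Or.inl ⟨rfl, fun i o => ?_⟩
  rcases o with c | ⟨k', s⟩
  · have hl := k.is_lt
    have h1 : l ≤ 12 := by omega
    have h2 : l + 1 ≤ 12 := by omega
    simp [regs, Gates.rect, writeGates, h1, h2]
  · by_cases hkk : k' = k
    · subst hkk
      have hr : (writeGates k' F G).rect (regs n N P tok l i) (.inr (k', s)) =
          ∑ j, max 0 (regs n N P tok l i ⬝ᵥ F s j) * G j := by
        simp only [Gates.rect, writeGates, if_true]
        rfl
      rw [hr, h i i.is_lt s]
      simp [regs, hk]
    · have h1 : ((k' : ℕ) < l + 1) ↔ ((k' : ℕ) < l) := by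
        have : (k' : ℕ) ≠ k := fun h => hkk (Fin.ext h)
        omega
      simp [regs, Gates.rect, writeGates, hkk, h1]

/-- The one-hot block and place of the query select rows of the tables, those of the key select
columns. Any table lookup is thus a bilinear score. -/
lemma step_fetchGates {l : ℕ} {k : Fin 12} (hk : (k : ℕ) = l) (hl : 1 < l)
    (hL : ∀ i < L, grp n i ≤ N)
    {t₁ t₂ t₃ : ℕ → ℕ → ℤ} {τ : ℕ → ℕ} (hτ : ∀ i, τ i ≤ i)
    (hmax : ∀ i, ∀ j ≤ i, j ≠ τ i →
      t₁ (grp n i) (grp n j) + (t₂ (grp n i) (off n j) + t₃ (off n i) (off n j)) <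
      t₁ (grp n i) (grp n (τ i)) + (t₂ (grp n i) (off n (τ i)) + t₃ (off n i) (off n (τ i))))
    (h : ∀ i s, content n P tok k i s = ibit (word (tok (τ i))) s) :
    (fetchGates k t₁ t₂ t₃).Step (fun i : Fin L => regs n N P tok l i)
      (fun i : Fin L => regs n N P tok (l + 1) i) := by
  have hkl := k.is_lt
  have h1 : l ≤ 12 := by omega
  have h2 : l + 1 ≤ 12 := by omega
  have hscore (i j : ℕ) (hi : i < L) (hj : j < L) :
      (fetchGates k t₁ t₂ t₃).score (regs n N P tok l i) (regs n N P tok l j) =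
      t₁ (grp n i) (grp n j) + (t₂ (grp n i) (off n j) + t₃ (off n i) (off n j)) := by
    have hq (b : Reg n N w) :
        ∑ a, regs n N P tok l i a * (fetchGates k t₁ t₂ t₃).M a b =
        (regForm 0 (fun s => t₁ (grp n i) s) +
          regForm 1 (fun s => t₂ (grp n i) s + t₃ (off n i) s) : Reg n N w → ℤ) b := by
      rcases b with c | ⟨k', s⟩
      · simp [fetchGates, regForm]
      · by_cases hk0 : k' = 0
        · subst hk0
          have := regs_dotProduct_grp (P := P) (tok := tok) (by omega : 0 < l) (hL i hi)
            (fun g => t₁ g s)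
          have hM : (fun a => (fetchGates k t₁ t₂ t₃).M a (.inr (0, s))) =
              (regForm 0 fun g => t₁ g s : Reg n N w → ℤ) := by
            funext a; simp [fetchGates]
          change regs n N P tok l i ⬝ᵥ (fun a => (fetchGates k t₁ t₂ t₃).M a (.inr (0, s))) = _
          rw [hM, this]
          simp [regForm]
        · by_cases hk1 : k' = 1
          · subst hk1
            have e1 := regs_dotProduct_grp (P := P) (tok := tok) (by omega : 0 < l) (hL i hi)
              (fun g => t₂ g s)
            have e2 := regs_dotProduct_off (n := n) (N := N) (P := P) (tok := tok) hl i (fun g => t₃ g s)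
            have hM : (fun a => (fetchGates k t₁ t₂ t₃).M a (.inr (1, s))) =
                (regForm 0 (fun g => t₂ g s) + regForm 1 (fun r => t₃ r s) : Reg n N w → ℤ) := by
              funext a; simp [fetchGates]
            change regs n N P tok l i ⬝ᵥ (fun a => (fetchGates k t₁ t₂ t₃).M a (.inr (1, s))) = _
            rw [hM, dotProduct_add, e1, e2]
            simp [regForm]
          · simp [fetchGates, hk0, hk1, regForm]
    have := regs_dotProduct_grp (P := P) (tok := tok) (by omega : 0 < l) (hL j hj)
      (fun s => t₁ (grp n i) s)
    have h' := regs_dotProduct_off (n := n) (N := N) (P := P) (tok := tok) hl j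
      (fun s => t₂ (grp n i) s + t₃ (off n i) s)
    rw [Gates.score, ← this, ← h', ← dotProduct_add]
    exact Finset.sum_congr rfl fun b _ => by rw [hq, mul_comm]
  refine Or.inr ⟨rfl, fun i => ⟨τ i, (hτ i).trans_lt i.is_lt⟩, fun i => ⟨hτ i, ?_, ?_⟩⟩
  · intro j hj hne
    rw [hscore _ _ i.is_lt j.is_lt, hscore _ _ i.is_lt ((hτ i).trans_lt i.is_lt)]
    exact hmax i j hj fun h => hne (Fin.ext h)
  · intro o
    rcases o with c | ⟨k', s⟩
    · simp [regs, fetchGates, h1, h2]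
    · by_cases hkk : k' = k
      · subst hkk
        by_cases hs : (s : ℕ) < w
        · have := dotProduct_inForm (regs n N P tok l (τ i)) (by omega : (s : ℕ) < w + 2) 1
          have hV : ∑ a, regs n N P tok l (τ i) a * (fetchGates k' t₁ t₂ t₃).V a (.inr (k', s)) =
              regs n N P tok l (τ i) ⬝ᵥ inForm s 1 := by
            simp only [fetchGates, hs, and_self, if_true]
            rfl
          rw [hV, this]
          simp [regs, hk, hs, h, h1]
        · simp [regs, fetchGates, hk, hs, h, ibit_eq_zero (not_lt.1 hs)]
      · have h1 : ((k' : ℕ) < l + 1) ↔ ((k' : ℕ) < l) := by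
          have : (k' : ℕ) ≠ k := fun h => hkk (Fin.ext h)
          omega
        simp [regs, fetchGates, hkk, h1]

end Steps

/-! ### Correctness of each layer of the Mersenne Twister network. -/

section Steps

variable {n N w L : ℕ} {P : MTParams w} {tok : ℕ → Token w}

/-- The zigzag with slopes 1, -1, 1 and breakpoints 0, 1, 2 passes through 0, 1, 0, 1. -/
lemma max_parity {z : ℤ} (h0 : 0 ≤ z) (h3 : z ≤ 3) :
    max 0 z * 1 + max 0 (z - 1) * -2 + max 0 (z - 2) * 2 = z % 2 := by
  omega

lemma max_bump (z : ℤ) :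
    max 0 (z + 1) * 1 + max 0 z * -2 + max 0 (z - 1) * 1 = if z = 0 then 1 else 0 := by
  split_ifs <;> omega

lemma regs_parityForms {l i : ℕ} {f : Reg n N w → ℤ} (h0 : 0 ≤ regs n N P tok l i ⬝ᵥ f)
    (h3 : regs n N P tok l i ⬝ᵥ f ≤ 3) :
    ∑ j, max 0 (regs n N P tok l i ⬝ᵥ parityForms f j) * (![1, -2, 2, 0] : Fin 4 → ℤ) j =
      (regs n N P tok l i ⬝ᵥ f) % 2 := by
  rw [← max_parity h0 h3, Fin.sum_univ_four]
  simp [parityForms, dotProduct_sub, regs_dotProduct_const]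

lemma regs_bumpForms {l i : ℕ} {f : Reg n N w → ℤ} :
    ∑ j, max 0 (regs n N P tok l i ⬝ᵥ bumpForms f j) * (![1, -2, 1, 0] : Fin 4 → ℤ) j =
      if regs n N P tok l i ⬝ᵥ f = 0 then 1 else 0 := by
  rw [← max_bump, Fin.sum_univ_four]
  simp [bumpForms, dotProduct_sub, dotProduct_add, regs_dotProduct_const]

lemma ibit_nonneg (v : BitVec w) (s : ℕ) : 0 ≤ ibit v s := by
  unfold ibit; split_ifs <;> simp

lemma ibit_le_one (v : BitVec w) (s : ℕ) : ibit v s ≤ 1 := by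
  unfold ibit; split_ifs <;> simp

lemma ibit_xor (v v' : BitVec w) (s : ℕ) : ibit (v ^^^ v') s = (ibit v s + ibit v' s) % 2 := by
  unfold ibit
  rw [BitVec.getLsbD_xor]
  cases v.getLsbD s <;> cases v'.getLsbD s <;> simp

lemma step_block :
    (mtGates P n N 0).Step (fun i : Fin L => regs n N P tok 0 i)
      (fun i : Fin L => regs n N P tok 1 i) := by
  refine step_writeGates (l := 0) (k := 0) rfl fun i _ s => ?_
  have h := grp_mul_add_off (n := n) i
  have ho := off_lt (n := n) i
  simp only [Fin.sum_univ_four, Matrix.cons_val, dotProduct_add, regs_dotProduct_pos,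
    regs_dotProduct_const]
  change _ = if s = grp n i then (1 : ℤ) else 0
  have h' : (i : ℤ) + 2 = grp n i * (n + 2) + off n i := by exact_mod_cast h.symm
  have ho' : (off n i : ℤ) < n + 2 := by exact_mod_cast ho
  rcases lt_trichotomy s (grp n i) with hs | hs | hs
  · rw [if_neg hs.ne]
    have : ((s : ℤ) + 1) * (n + 2) ≤ grp n i * (n + 2) :=
      mul_le_mul_of_nonneg_right (by exact_mod_cast hs) (by positivity)
    have e : ((s : ℤ) + 1) * (n + 2) = s * (n + 2) + (n + 2) := by ring
    rw [e] at this ⊢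
    generalize (s : ℤ) * (n + 2) = a at *
    generalize (grp n i : ℤ) * (n + 2) = b at *
    omega
  · rw [if_pos hs, hs]
    have e : ((grp n i : ℤ) + 1) * (n + 2) = grp n i * (n + 2) + (n + 2) := by ring
    rw [e]
    generalize (grp n i : ℤ) * (n + 2) = b at *
    omega
  · rw [if_neg hs.ne']
    have : ((grp n i : ℤ) + 1) * (n + 2) ≤ s * (n + 2) :=
      mul_le_mul_of_nonneg_right (by exact_mod_cast hs) (by positivity)
    have e : ((s : ℤ) + 1) * (n + 2) = s * (n + 2) + (n + 2) := by ring
    have e' : ((grp n i : ℤ) + 1) * (n + 2) = grp n i * (n + 2) + (n + 2) := by ring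
    rw [e]
    rw [e'] at this
    generalize (s : ℤ) * (n + 2) = a at *
    generalize (grp n i : ℤ) * (n + 2) = b at *
    omega

lemma step_place (hL : ∀ i < L, grp n i ≤ N) :
    (mtGates P n N 1).Step (fun i : Fin L => regs n N P tok 1 i)
      (fun i : Fin L => regs n N P tok 2 i) := by
  refine step_writeGates (l := 1) (k := 1) rfl fun i hi s => ?_
  have h' : (grp n i : ℤ) * (n + 2) + off n i = i + 2 := by
    exact_mod_cast grp_mul_add_off (n := n) i
  simp only [regs_bumpForms, dotProduct_add, dotProduct_sub, regs_dotProduct_pos,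
    regs_dotProduct_const, regs_dotProduct_grp one_pos (hL i hi)]
  change _ = if s = off n i then (1 : ℤ) else 0
  congr 1
  rw [eq_iff_iff]
  generalize (grp n i : ℤ) * (n + 2) = b at *
  omega

/-- The source earns both points. Since block and place determine the index, every other index
misses at least one. -/
lemma fetch_max [NeZero n] (s : ℕ) (i j : ℕ) (hne : j ≠ fetchSrc n s i) :
    (if grp n j = grp n i - 1 then (1 : ℤ) else 0) +
      ((if off n j = fetchOff n s (grp n i) then 1 else 0) + 0) <
    (if grp n (fetchSrc n s i) = grp n i - 1 then 1 else 0) +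
      ((if off n (fetchSrc n s i) = fetchOff n s (grp n i) then 1 else 0) + 0) := by
  obtain ⟨h1, h2⟩ := grp_off_fetchSrc (n := n) s i
  rw [if_pos h1, if_pos h2]
  by_cases h : grp n j = grp n i - 1 ∧ off n j = fetchOff n s (grp n i)
  · exact absurd (eq_of_grp_off (h.1.trans h1.symm) (h.2.trans h2.symm)) hne
  · split_ifs <;> simp_all

/-- With a preceding block, the source scores at least 3 + 2; the right block with a wrong place
gives at most 3 + 1, a wrong block at most 2 + 1. The extra point for the query's own place breaks
the tie in block 0, where the wanted place is either still in the future or the current one. -/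
lemma copy_max [NeZero n] (i j : ℕ) (hj : j ≤ i) (hne : j ≠ copySrc n i) :
    (if grp n j = grp n i - 1 then (3 : ℤ) else 0) +
      (0 + ((if off n j = copyOff n (off n i) then 2 else 0) + if off n j = off n i then 1 else 0)) <
    (if grp n (copySrc n i) = grp n i - 1 then 3 else 0) +
      (0 + ((if off n (copySrc n i) = copyOff n (off n i) then 2 else 0) +
        if off n (copySrc n i) = off n i then 1 else 0)) := by
  by_cases hg : grp n i = 0
  · have hs : copySrc n i = i := by simp [copySrc, hg]
    rw [hs] at hne ⊢
    have h1 := grp_mul_add_off (n := n) i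
    have h2 := grp_mul_add_off (n := n) j
    have h3 : grp n j = 0 := Nat.le_zero.1 (hg ▸ grp_mono (n := n) hj)
    have h5 := off_lt (n := n) i
    rw [hg] at h1
    rw [h3] at h2
    have h4 : off n j ≠ copyOff n (off n i) := by
      unfold copyOff
      split_ifs <;> omega
    have h6 : off n j ≠ off n i := by omega
    rw [if_neg h4, if_neg h6, if_pos (by omega : grp n j = grp n i - 1),
      if_pos (by omega : grp n i = grp n i - 1), if_pos (rfl : off n i = off n i)]
    split_ifs <;> simp
  · obtain ⟨h1, h2⟩ := grp_off_copySrc (n := n) hg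
    rw [if_pos h1, if_pos h2]
    by_cases h : grp n j = grp n i - 1 ∧ off n j = copyOff n (off n i)
    · exact absurd (eq_of_grp_off (h.1.trans h1.symm) (h.2.trans h2.symm)) hne
    · have h3 : (0 : ℤ) ≤ if off n (copySrc n i) = off n i then 1 else 0 := by split_ifs <;> simp
      by_cases h4 : grp n j = grp n i - 1
      · rw [if_pos h4, if_neg fun h' => h ⟨h4, h'⟩]
        split_ifs <;> omega
      · rw [if_neg h4]
        split_ifs <;> omega

lemma regs_mixForm {l i s : ℕ} (hl : 3 < l) :
    regs n N P tok l i ⬝ᵥ mixForm P s =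
      ibit ((word (tok (fetchSrc n 0 i)) &&& P.upper) |||
        (word (tok (fetchSrc n 1 i)) &&& P.lower)) s := by
  have h2 := regs_dotProduct_rd_ibit (n := n) (N := N) (P := P) (tok := tok) (l := l) (k := 2)
    (i := i) (by change 2 < l; omega) (fun _ => rfl) s
  have h3 := regs_dotProduct_rd_ibit (n := n) (N := N) (P := P) (tok := tok) (l := l) (k := 3)
    (i := i) (by change 3 < l; omega) (fun _ => rfl) s
  unfold mixForm
  by_cases hs : s < w
  · split_ifs with hu
    · rw [h2]
      simp only [ibit, MTParams.lower, BitVec.getLsbD_or, BitVec.getLsbD_and, BitVec.getLsbD_not,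
        hu, Bool.not_true, Bool.and_true, Bool.and_false, Bool.or_false]
    · rw [h3]
      rw [Bool.not_eq_true] at hu
      simp only [ibit, MTParams.lower, BitVec.getLsbD_or, BitVec.getLsbD_and, BitVec.getLsbD_not,
        hu, hs, decide_true, Bool.not_false, Bool.and_true, Bool.and_false, Bool.false_or]
  · split_ifs with hu
    · rw [h2, ibit_eq_zero (not_lt.1 hs), ibit_eq_zero (not_lt.1 hs)]
    · rw [h3, ibit_eq_zero (not_lt.1 hs), ibit_eq_zero (not_lt.1 hs)]

lemma step_twist :
    (mtGates P n N 6).Step (fun i : Fin L => regs n N P tok 6 i)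
      (fun i : Fin L => regs n N P tok 7 i) := by
  refine step_writeGates (l := 6) (k := 6) rfl fun i hi s => ?_
  have h4 := regs_dotProduct_rd_ibit (n := n) (N := N) (P := P) (tok := tok) (l := 6) (k := 4)
    (i := i) (by decide) (fun _ => rfl) s
  set t := (word (tok (fetchSrc n 0 i)) &&& P.upper) |||
        (word (tok (fetchSrc n 1 i)) &&& P.lower) with ht
  have hform : regs n N P tok 6 i ⬝ᵥ (rd 4 s + mixForm P (s + 1) +
      if P.a.getLsbD s then mixForm P 0 else 0) = ibit (word (tok (fetchSrc n P.m i))) s +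
      ibit (t >>> 1) s + ibit (if t.getLsbD 0 then P.a else 0#w) s := by
    rw [dotProduct_add, dotProduct_add, h4, regs_mixForm (by norm_num)]
    congr 1
    · congr 1
      simp [ibit, BitVec.getLsbD_ushiftRight, add_comm, ht]
    · split_ifs with ha h0 h0
      · rw [regs_mixForm (by norm_num)]
        simp only [ibit, ← ht, h0, ha]
      · rw [regs_mixForm (by norm_num)]
        simp only [ibit, ← ht, h0]
        simp
      · simp [ibit, ha]
      · simp [ibit]
  have b1 := ibit_nonneg (word (tok (fetchSrc n P.m i))) s
  have b2 := ibit_nonneg (t >>> 1) s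
  have b3 := ibit_nonneg (if t.getLsbD 0 then P.a else 0#w) s
  have c1 := ibit_le_one (word (tok (fetchSrc n P.m i))) s
  have c2 := ibit_le_one (t >>> 1) s
  have c3 := ibit_le_one (if t.getLsbD 0 then P.a else 0#w) s
  rw [regs_parityForms (by rw [hform]; omega) (by rw [hform]; omega), hform]
  change _ = ibit (word (tok (fetchSrc n P.m i)) ^^^ (t >>> 1) ^^^
    (if t.getLsbD 0 then P.a else 0#w)) s
  rw [ibit_xor, ibit_xor]
  omega

lemma step_shiftRight {l : ℕ} {k k' : Fin 12} {u : ℕ} {v : ℕ → BitVec w}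
    (hk : (k : ℕ) < l) (hk' : (k' : ℕ) = l) (hv : ∀ i s, content n P tok k i s = ibit (v i) s)
    (hv' : ∀ i s, content n P tok k' i s = ibit (v i ^^^ (v i >>> u)) s) :
    (writeGates k' (fun s => parityForms (shiftRightForm k u s)) ![1, -2, 2, 0]).Step
      (fun i : Fin L => regs n N P tok l i) (fun i : Fin L => regs n N P tok (l + 1) i) := by
  refine step_writeGates hk' fun i hi s => ?_
  have hform : regs n N P tok l i ⬝ᵥ shiftRightForm k u s =
      ibit (v i) s + ibit (v i >>> u) s := by
    rw [shiftRightForm, dotProduct_add, regs_dotProduct_rd_ibit hk (hv i),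
      regs_dotProduct_rd_ibit hk (hv i)]
    simp [ibit, BitVec.getLsbD_ushiftRight]
  have b1 := ibit_nonneg (v i) s
  have b2 := ibit_nonneg (v i >>> u) s
  have c1 := ibit_le_one (v i) s
  have c2 := ibit_le_one (v i >>> u) s
  rw [regs_parityForms (by rw [hform]; omega) (by rw [hform]; omega), hform, hv', ibit_xor]

lemma step_shiftLeft {l : ℕ} {k k' : Fin 12} {u : ℕ} {b : BitVec w} {v : ℕ → BitVec w}
    (hk : (k : ℕ) < l) (hk' : (k' : ℕ) = l) (hv : ∀ i s, content n P tok k i s = ibit (v i) s)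
    (hv' : ∀ i s, content n P tok k' i s = ibit (v i ^^^ ((v i <<< u) &&& b)) s) :
    (writeGates k' (fun s => parityForms (shiftLeftForm k u b s)) ![1, -2, 2, 0]).Step
      (fun i : Fin L => regs n N P tok l i) (fun i : Fin L => regs n N P tok (l + 1) i) := by
  refine step_writeGates hk' fun i hi s => ?_
  have hform : regs n N P tok l i ⬝ᵥ shiftLeftForm k u b s =
      ibit (v i) s + ibit ((v i <<< u) &&& b) s := by
    rw [shiftLeftForm, dotProduct_add, regs_dotProduct_rd_ibit hk (hv i)]
    congr 1
    split_ifs with h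
    · rw [regs_dotProduct_rd_ibit hk (hv i)]
      have hs : s < w := BitVec.lt_of_getLsbD h.2
      have h1 : ¬ s < u := by omega
      simp only [ibit, BitVec.getLsbD_and, BitVec.getLsbD_shiftLeft, h.2, hs, h1, decide_true,
        decide_false, Bool.not_false, Bool.true_and, Bool.and_true]
    · rw [dotProduct_zero, ibit, if_neg]
      rw [BitVec.getLsbD_and, BitVec.getLsbD_shiftLeft]
      simp only [Bool.and_eq_true, Bool.not_eq_true', decide_eq_false_iff_not, decide_eq_true_eq,
        not_and] at *
      intro h1 h2
      exact h (by omega) h2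
  have b1 := ibit_nonneg (v i) s
  have b2 := ibit_nonneg ((v i <<< u) &&& b) s
  have c1 := ibit_le_one (v i) s
  have c2 := ibit_le_one ((v i <<< u) &&& b) s
  rw [regs_parityForms (by rw [hform]; omega) (by rw [hform]; omega), hform, hv', ibit_xor]

lemma step_select (hL : ∀ i < L, grp n i ≤ N) :
    (mtGates P n N 11).Step (fun i : Fin L => regs n N P tok 11 i)
      (fun i : Fin L => regs n N P tok 12 i) := by
  refine step_writeGates (l := 11) (k := 11) rfl fun i hi s => ?_
  simp only [regs_bumpForms, dotProduct_sub, regs_dotProduct_const,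
    regs_dotProduct_grp (by norm_num : 0 < 11) (hL i hi),
    regs_dotProduct_off (by norm_num : 1 < 11)]
  change _ = if off n i = 1 + (grp n i - 1) % n then (1 : ℤ) else 0
  congr 1
  rw [eq_iff_iff]
  omega

lemma step_output [NeZero n] :
    (mtGates P n N 12).Step (fun i : Fin L => regs n N P tok 12 i)
      (fun i : Fin L => regs n N P tok 13 i) := by
  refine Or.inl ⟨rfl, fun i o => ?_⟩
  rcases o with c | ⟨k, s⟩
  · by_cases hc : (c : ℕ) < w
    · have hr : (mtGates P n N 12).rect (regs n N P tok 12 i) (.inl c) =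
          max 0 (regs n N P tok 12 i ⬝ᵥ (rd 10 c + rd 1 0 - constForm 1)) +
          max 0 (regs n N P tok 12 i ⬝ᵥ (rd 6 c + rd 11 0 - constForm 1)) +
          max 0 (regs n N P tok 12 i ⬝ᵥ (rd 5 c - rd 1 0 - rd 11 0 - rd 1 (n + 1))) -
          max 0 (regs n N P tok 12 i ⬝ᵥ inForm c 1) := by
        simp only [Gates.rect, Fin.sum_univ_four, mtGates, replaceGates, hc, if_true,
          Matrix.cons_val, mul_one, mul_neg, ← sub_eq_add_neg]
        rfl
      have e10 := regs_dotProduct_rd_ibit (n := n) (N := N) (P := P) (tok := tok) (l := 12)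
        (k := 10) (i := i) (by decide) (fun _ => rfl) c
      have e6 := regs_dotProduct_rd_ibit (n := n) (N := N) (P := P) (tok := tok) (l := 12)
        (k := 6) (i := i) (by decide) (fun _ => rfl) c
      have e5 := regs_dotProduct_rd_ibit (n := n) (N := N) (P := P) (tok := tok) (l := 12)
        (k := 5) (i := i) (by decide) (fun _ => rfl) c
      have e11 : regs n N P tok 12 i ⬝ᵥ rd 11 0 =
          if off n i = 1 + (grp n i - 1) % n then 1 else 0 := by
        rw [regs_dotProduct_rd (by decide), if_pos (by omega)]; rfl
      have e1 : regs n N P tok 12 i ⬝ᵥ rd 1 0 = if 0 = off n i then 1 else 0 := by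
        rw [regs_dotProduct_rd (by decide), if_pos (by omega)]; rfl
      have e1' : regs n N P tok 12 i ⬝ᵥ rd 1 (n + 1) = if n + 1 = off n i then 1 else 0 := by
        rw [regs_dotProduct_rd (by decide), if_pos (by omega)]; rfl
      have ein : regs n N P tok 12 i ⬝ᵥ inForm c 1 = ibit (word (tok i)) c := by
        rw [dotProduct_inForm _ c.is_lt]; simp [regs, hc]
      -- `1 + (grp n i - 1) % n` lies between 1 and `n`, so the three gates exclude each other.
      have hm := Nat.mod_lt (grp n i - 1) (Nat.pos_of_neZero n)
      have hX : regs n N P tok 12 i (.inl c) = ibit (word (tok i)) c := by simp [regs, hc]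
      have hY : regs n N P tok 13 i (.inl c) = ibit (outWord n P tok i) c := by simp [regs, hc]
      change regs n N P tok 13 i (.inl c) = regs n N P tok 12 i (.inl c) +
        (mtGates P n N 12).rect (regs n N P tok 12 i) (.inl c)
      rw [hr, hX, hY]
      simp only [dotProduct_add, dotProduct_sub, e10, e6, e5, e11, e1, e1', ein,
        regs_dotProduct_const]
      have a1 := ibit_nonneg (P.temper (newWord n P tok i)) c
      have a2 := ibit_nonneg (newWord n P tok i) c
      have a3 := ibit_nonneg (word (tok (copySrc n i))) c
      have a4 := ibit_nonneg (word (tok i)) c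
      have b1 := ibit_le_one (P.temper (newWord n P tok i)) c
      have b2 := ibit_le_one (newWord n P tok i) c
      have b3 := ibit_le_one (word (tok (copySrc n i))) c
      have hz : ibit (0#w) c = 0 := by simp [ibit]
      unfold outWord
      split_ifs <;> omega
    · simp [regs, hc, Gates.rect, mtGates, replaceGates]
  · have h1 : (k : ℕ) < 12 := k.is_lt
    have h2 : (k : ℕ) < 13 := by omega
    simp [regs, Gates.rect, mtGates, replaceGates, h1, h2]

lemma step_idle {l : ℕ} (hl : 13 ≤ l) :
    (⟨0, 0, 0, 0⟩ : Gates (Reg n N w)).Step (fun i : Fin L => regs n N P tok l i)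
      (fun i : Fin L => regs n N P tok (l + 1) i) := by
  refine Or.inl ⟨rfl, fun i o => ?_⟩
  rcases o with c | ⟨k, s⟩
  · have h1 : ¬ l ≤ 12 := by omega
    have h2 : ¬ l + 1 ≤ 12 := by omega
    simp [regs, Gates.rect, h1, h2]
  · have h1 : (k : ℕ) < l := by omega
    have h2 : (k : ℕ) < l + 1 := by omega
    simp [regs, Gates.rect, h1, h2]

lemma step_mtGates [NeZero n] (hL : ∀ i < L, grp n i ≤ N) (l : ℕ) :
    (mtGates P n N l).Step (fun i : Fin L => regs n N P tok l i)
      (fun i : Fin L => regs n N P tok (l + 1) i) := by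
  match l with
  | 0 => exact step_block
  | 1 => exact step_place hL
  | 2 =>
    exact step_fetchGates rfl (by norm_num) hL (fetchSrc_le 0)
      (fun i j _ hne => fetch_max 0 i j hne) fun _ _ => rfl
  | 3 =>
    exact step_fetchGates rfl (by norm_num) hL (fetchSrc_le 1)
      (fun i j _ hne => fetch_max 1 i j hne) fun _ _ => rfl
  | 4 =>
    exact step_fetchGates rfl (by norm_num) hL (fetchSrc_le P.m)
      (fun i j _ hne => fetch_max P.m i j hne) fun _ _ => rfl
  | 5 =>
    exact step_fetchGates rfl (by norm_num) hL copySrc_le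
      (fun i j hj hne => copy_max i j hj hne) fun _ _ => rfl
  | 6 => exact step_twist
  | 7 =>
    exact step_shiftRight (v := fun i => newWord n P tok i) (by decide) rfl
      (fun _ _ => rfl) fun _ _ => rfl
  | 8 =>
    exact step_shiftLeft (v := fun i => temper₁ P (newWord n P tok i)) (by decide) rfl
      (fun _ _ => rfl) fun _ _ => rfl
  | 9 =>
    exact step_shiftLeft (v := fun i => temper₂ P (newWord n P tok i)) (by decide) rfl
      (fun _ _ => rfl) fun _ _ => rfl
  | 10 =>
    exact step_shiftRight (v := fun i => temper₃ P (newWord n P tok i)) (by decide) rfl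
      (fun _ _ => rfl) fun _ _ => rfl
  | 11 => exact step_select hL
  | 12 => exact step_output
  | l + 13 => exact step_idle (by omega)

end Steps

/-! ## Size of the weights -/

section Bounds

variable {n N w : ℕ}

lemma bounded_writeGates {R : ℤ} (hR : 0 ≤ R) {k : Fin 12} {F : ℕ → Fin 4 → Reg n N w → ℤ}
    {G : Fin 4 → ℤ} (hF : ∀ s < n + N + w + 2, ∀ j a, |F s j a| ≤ R) (hG : ∀ j, |G j| ≤ R) :
    (writeGates k F G).Bounded R := by
  refine ⟨fun a b => by simpa [writeGates] using hR, fun a b => by simpa [writeGates] using hR,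
    fun o j a => ?_, fun o j => ?_⟩
  · rcases o with c | ⟨k', s⟩
    · simpa [writeGates] using hR
    · by_cases h : k' = k
      · simpa [writeGates, h] using hF s s.is_lt j a
      · simpa [writeGates, h] using hR
  · rcases o with c | ⟨k', s⟩
    · simpa [writeGates] using hR
    · by_cases h : k' = k
      · simpa [writeGates, h] using hG j
      · simpa [writeGates, h] using hR

lemma bounded_fetchGates {R : ℤ} (hR : 6 ≤ R) {k : Fin 12} {t₁ t₂ t₃ : ℕ → ℕ → ℤ}
    (h₁ : ∀ a b, |t₁ a b| ≤ 3) (h₂ : ∀ a b, |t₂ a b| ≤ 3) (h₃ : ∀ a b, |t₃ a b| ≤ 3) :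
    (fetchGates k t₁ t₂ t₃ : Gates (Reg n N w)).Bounded R := by
  have hR0 : 0 ≤ R := by omega
  refine ⟨fun a b => ?_, fun a b => ?_, fun o j a => by simpa [fetchGates] using hR0,
    fun o j => by simpa [fetchGates] using hR0⟩
  · rcases b with c | ⟨k', s⟩
    · simpa [fetchGates] using hR0
    · have e₁ := abs_regForm_le (n := n) (N := N) (w := w) (k := 0) (f := fun g => t₁ g s)
        (by norm_num : (0 : ℤ) ≤ 3) (fun g _ => h₁ g s) a
      have e₂ := abs_regForm_le (n := n) (N := N) (w := w) (k := 0) (f := fun g => t₂ g s)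
        (by norm_num : (0 : ℤ) ≤ 3) (fun g _ => h₂ g s) a
      have e₃ := abs_regForm_le (n := n) (N := N) (w := w) (k := 1) (f := fun g => t₃ g s)
        (by norm_num : (0 : ℤ) ≤ 3) (fun g _ => h₃ g s) a
      simp only [fetchGates]
      split_ifs
      · omega
      · rw [Pi.add_apply]
        exact (abs_add_le _ _).trans (by omega)
      · simpa using hR0
  · rcases b with c | ⟨k', s⟩
    · simpa [fetchGates] using hR0
    · simp only [fetchGates]
      split_ifs
      · exact (abs_inForm_le _ _ _).trans (by simp; omega)
      · simpa using hR0

lemma bounded_replaceGates {R : ℤ} (hR : 0 ≤ R) {F : ℕ → Fin 4 → Reg n N w → ℤ}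
    {G : Fin 4 → ℤ} (hF : ∀ s j a, |F s j a| ≤ R) (hG : ∀ j, |G j| ≤ R) :
    (replaceGates F G).Bounded R := by
  refine ⟨fun a b => by simpa [replaceGates] using hR, fun a b => by simpa [replaceGates] using hR,
    fun o j a => ?_, fun o j => ?_⟩
  · rcases o with c | ⟨k', s⟩
    · exact hF c j a
    · simpa [replaceGates] using hR
  · rcases o with c | ⟨k', s⟩
    · by_cases h : (c : ℕ) < w
      · simpa [replaceGates, h] using hG j
      · simpa [replaceGates, h] using hR
    · simpa [replaceGates] using hR

lemma abs_constForm_le (z : ℤ) (a : Reg n N w) : |constForm z a| ≤ |z| := abs_inForm_le _ _ _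

lemma abs_parityForms_le {f : Reg n N w → ℤ} {b : ℤ} (hf : ∀ a, |f a| ≤ b) (j : Fin 4)
    (a : Reg n N w) : |parityForms f j a| ≤ b + 2 := by
  have h := abs_le.1 (hf a)
  have h1 := abs_le.1 (abs_constForm_le (n := n) (N := N) (w := w) 1 a)
  have h2 := abs_le.1 (abs_constForm_le (n := n) (N := N) (w := w) 2 a)
  rw [abs_le]
  simp only [abs_one, Nat.abs_ofNat] at h1 h2
  fin_cases j <;> simp [parityForms] <;> omega

lemma abs_bumpForms_le {f : Reg n N w → ℤ} {b : ℤ} (hf : ∀ a, |f a| ≤ b) (j : Fin 4)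
    (a : Reg n N w) : |bumpForms f j a| ≤ b + 1 := by
  have h := abs_le.1 (hf a)
  have h1 := abs_le.1 (abs_constForm_le (n := n) (N := N) (w := w) 1 a)
  rw [abs_le]
  simp only [abs_one] at h1
  fin_cases j <;> simp [bumpForms] <;> omega

variable {P : MTParams w}

lemma abs_mixForm_le (s : ℕ) (a : Reg n N w) : |mixForm P s a| ≤ 1 := by
  unfold mixForm
  split_ifs <;> exact abs_rd_le _ _ _

lemma abs_shiftRightForm_le (k : Fin 12) (u s : ℕ) (a : Reg n N w) :
    |shiftRightForm k u s a| ≤ 2 :=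
  (abs_add_le _ _).trans (add_le_add (abs_rd_le k s a) (abs_rd_le k (u + s) a))

lemma abs_shiftLeftForm_le (k : Fin 12) (u : ℕ) (b : BitVec w) (s : ℕ) (a : Reg n N w) :
    |shiftLeftForm k u b s a| ≤ 2 := by
  have h : |(if u ≤ s ∧ b.getLsbD s then rd k (s - u) else 0 : Reg n N w → ℤ) a| ≤ 1 := by
    split_ifs
    · exact abs_rd_le _ _ _
    · simp
  exact (abs_add_le _ _).trans (add_le_add (abs_rd_le k s a) h)

/-- The dominant entries are the multiples of `n + 2` in the two layers that decompose the position;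
all other entries are at most linear in the array length. -/
lemma bounded_mtGates [NeZero n] {R : ℕ} (hR : 2 * ((n + N + w + 2) * (n + 2)) + 20 ≤ R) (l : ℕ) :
    (mtGates P n N l).Bounded R := by
  have hR' : 2 * (((n : ℤ) + N + w + 2) * (n + 2)) + 20 ≤ R := by exact_mod_cast hR
  have hS0 : (0 : ℤ) ≤ ((n : ℤ) + N + w + 2) * (n + 2) := by positivity
  have hS1 : ((n : ℤ) + N + w + 2) ≤ ((n : ℤ) + N + w + 2) * (n + 2) :=
    le_mul_of_one_le_right (by positivity) (by omega)
  have hR0 : (0 : ℤ) ≤ R := by omega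
  have hG {a b c d : ℤ} (ha : |a| ≤ 2) (hb : |b| ≤ 2) (hc : |c| ≤ 2) (hd : |d| ≤ 2) (j : Fin 4) :
      |(![a, b, c, d] : Fin 4 → ℤ) j| ≤ (R : ℤ) := by
    fin_cases j <;> simp <;> omega
  have hpar {k : Fin 12} {F : ℕ → Reg n N w → ℤ} (hF : ∀ s a, |F s a| ≤ 3) :
      (writeGates k (fun s => parityForms (F s)) ![1, -2, 2, 0]).Bounded R :=
    bounded_writeGates hR0 (fun s _ j a => (abs_parityForms_le (hF s) j a).trans (by omega))
      (hG (by simp) (by simp) (by simp) (by simp))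
  have hfetch {k : Fin 12} {s : ℕ} : (fetchGates k (fun g b => if b = g - 1 then 1 else 0)
      (fun g b => if b = fetchOff n s g then 1 else 0) 0 : Gates (Reg n N w)).Bounded R :=
    bounded_fetchGates (by omega) (fun a b => by split_ifs <;> simp)
      (fun a b => by split_ifs <;> simp) (fun a b => by simp)
  have hin (c : ℕ) (a : Reg n N w) : |inForm c 1 a| ≤ 1 := by simpa using abs_inForm_le c 1 a
  match l with
  | 0 =>
    rw [mtGates]
    refine bounded_writeGates hR0 (fun s hs j a => ?_)
      (hG (by simp) (by simp) (by simp) (by simp))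
    have h1 : ((s : ℤ) + 1) * (n + 2) ≤ (n + N + w + 2) * (n + 2) :=
      mul_le_mul_of_nonneg_right (by omega) (by omega)
    have h2 : (0 : ℤ) ≤ s * (n + 2) := by positivity
    have e : ((s : ℤ) + 1) * (n + 2) = s * (n + 2) + (n + 2) := by ring
    have key (z : ℤ) (hz : |z| ≤ ((n : ℤ) + N + w + 2) * (n + 2) + 2) :
        |(inForm w 1 + constForm z : Reg n N w → ℤ) a| ≤ R := by
      refine (abs_add_le _ _).trans ?_
      have := hin w a
      have := abs_constForm_le z a
      omega
    rw [e] at h1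
    fin_cases j <;> refine key _ (abs_le.2 ?_) <;> (try rw [e]) <;>
      generalize (s : ℤ) * (n + 2) = u at * <;>
      generalize ((n : ℤ) + N + w + 2) * (n + 2) = v at * <;> omega
  | 1 =>
    rw [mtGates]
    refine bounded_writeGates hR0 (fun s hs j a => ?_)
      (hG (by simp) (by simp) (by simp) (by simp))
    refine (abs_bumpForms_le (b := R - 1) (fun a => ?_) j a).trans (by omega)
    have h1 := abs_le.1 (hin w a)
    have h2 := abs_le.1 (abs_constForm_le (1 - s) a)
    have h3 : |(1 - s : ℤ)| ≤ n + N + w + 2 := abs_le.2 ⟨by omega, by omega⟩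
    have h4 := abs_le.1 (abs_regForm_le (k := 0) (f := fun g => (g : ℤ) * (n + 2)) hS0
      (fun g hg => by
        rw [abs_of_nonneg (by positivity)]
        exact mul_le_mul_of_nonneg_right (by exact_mod_cast hg.le) (by positivity)) a)
    rw [abs_le, Pi.sub_apply, Pi.add_apply]
    generalize ((n : ℤ) + N + w + 2) * (n + 2) = v at *
    omega
  | 2 =>
    rw [mtGates]
    exact hfetch
  | 3 =>
    rw [mtGates]
    exact hfetch
  | 4 =>
    rw [mtGates]
    exact hfetch
  | 5 =>
    rw [mtGates]
    exact bounded_fetchGates (by omega) (fun a b => by split_ifs <;> simp)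
      (fun a b => by simp) (fun a b => by split_ifs <;> simp)
  | 6 =>
    rw [mtGates]
    refine hpar fun s a => ?_
    have h1 := abs_rd_le 4 s a
    have h2 := abs_mixForm_le (P := P) (s + 1) a
    have h3 : |(if P.a.getLsbD s then mixForm P 0 else 0 : Reg n N w → ℤ) a| ≤ 1 := by
      split_ifs
      · exact abs_mixForm_le _ _
      · simp
    refine (abs_add_le _ _).trans ?_
    have := abs_add_le (rd 4 s a) (mixForm P (s + 1) a)
    rw [Pi.add_apply]
    omega
  | 7 =>
    rw [mtGates]
    exact hpar fun s a => (abs_shiftRightForm_le _ _ _ _).trans (by norm_num)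
  | 8 =>
    rw [mtGates]
    exact hpar fun s a => (abs_shiftLeftForm_le _ _ _ _ _).trans (by norm_num)
  | 9 =>
    rw [mtGates]
    exact hpar fun s a => (abs_shiftLeftForm_le _ _ _ _ _).trans (by norm_num)
  | 10 =>
    rw [mtGates]
    exact hpar fun s a => (abs_shiftRightForm_le _ _ _ _).trans (by norm_num)
  | 11 =>
    rw [mtGates]
    refine bounded_writeGates hR0 (fun s hs j a => ?_)
      (hG (by simp) (by simp) (by simp) (by simp))
    refine (abs_bumpForms_le (b := R - 1) (fun a => ?_) j a).trans (by omega)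
    have h1 := abs_le.1 (abs_constForm_le 1 a)
    have h2 := abs_le.1 (abs_regForm_le (k := 1) (f := fun r => (r : ℤ))
      (by positivity : (0 : ℤ) ≤ n + N + w + 2)
      (fun r hr => by rw [abs_of_nonneg (by positivity)]; exact_mod_cast hr.le) a)
    have h3 := abs_le.1 (abs_regForm_le (k := 0) (f := fun g => ((g - 1) % n : ℕ))
      (by positivity : (0 : ℤ) ≤ n)
      (fun g _ => by
        rw [abs_of_nonneg (by positivity)]
        exact_mod_cast (Nat.mod_lt _ (Nat.pos_of_neZero n)).le) a)
    rw [abs_one] at h1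
    rw [abs_le, Pi.sub_apply, Pi.sub_apply]
    generalize ((n : ℤ) + N + w + 2) * (n + 2) = v at *
    omega
  | 12 =>
    rw [mtGates]
    refine bounded_replaceGates hR0 (fun s j a => ?_)
      (hG (by simp) (by simp) (by simp) (by simp))
    have h1 := abs_le.1 (abs_rd_le 10 s a)
    have h2 := abs_le.1 (abs_rd_le 1 0 a)
    have h3 := abs_le.1 (abs_rd_le 6 s a)
    have h4 := abs_le.1 (abs_rd_le 11 0 a)
    have h5 := abs_le.1 (abs_rd_le 5 s a)
    have h6 := abs_le.1 (abs_rd_le 1 (n + 1) a)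
    have h7 := abs_le.1 (abs_constForm_le 1 a)
    have h8 := abs_le.1 (hin s a)
    rw [abs_one] at h7
    rw [abs_le]
    fin_cases j <;> simp <;> omega
  | l + 13 => exact ⟨by simp [mtGates], by simp [mtGates], by simp [mtGates], by simp [mtGates]⟩

variable {tok : ℕ → Token w}

lemma abs_ibit_le (v : BitVec w) (s : ℕ) : |ibit v s| ≤ 1 := by
  unfold ibit; split_ifs <;> simp

lemma abs_content_le (k : Fin 12) (i s : ℕ) : |content n P tok k i s| ≤ 1 := by
  have hite (p : Prop) [Decidable p] : |if p then (1 : ℤ) else 0| ≤ 1 := by split_ifs <;> simp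
  unfold content
  split <;> simp only [abs_ibit_le, hite]

/-- Only the position register exceeds 1. -/
lemma abs_regs_le {R i : ℕ} (hi : i + 1 ≤ R) (l : ℕ) (o : Reg n N w) :
    |regs n N P tok l i o| ≤ R := by
  have hR : (1 : ℤ) ≤ R := by omega
  rcases o with c | ⟨k, s⟩
  · simp only [regs]
    split_ifs
    · exact (abs_ibit_le _ _).trans hR
    · exact (abs_ibit_le _ _).trans hR
    · rw [abs_of_nonneg (by positivity)]
      exact_mod_cast hi
    · simpa using hR
  · simp only [regs]
    split_ifs
    · exact (abs_content_le k i s).trans hR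
    · simp

end Bounds

/-! ## The sequence of tokens -/

section Sequence

variable {n w : ℕ} [NeZero n] (P : MTParams w) (x : Fin n → BitVec w)

/-- The token at index `i` of the prompt followed by the chain of thought. -/
def seqTok (i : ℕ) : Token w :=
  if off n i = 0 then none
  else if off n i = 1 then some (P.output x (grp n i - 1))
  else some (P.state x (grp n i) (Fin.ofNat n (off n i - 2)))

lemma seqTok_state {i g : ℕ} {j : Fin n} (h : g * (n + 2) + (j + 2) = i + 2) :
    seqTok P x i = some (P.state x g j) := by
  obtain ⟨h1, h2⟩ := grp_off_unique (by omega) h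
  have : Fin.ofNat n (j + 2 - 2) = j := Fin.ext (by simp)
  simp [seqTok, h1, h2]

lemma seqTok_output {i g : ℕ} (h : (g + 1) * (n + 2) + 1 = i + 2) :
    seqTok P x i = some (P.output x g) := by
  obtain ⟨h1, h2⟩ := grp_off_unique (by omega) h
  simp [seqTok, h1, h2]

lemma seqTok_sep {i g : ℕ} (h : g * (n + 2) = i + 2) : seqTok P x i = none := by
  obtain ⟨h1, h2⟩ := grp_off_unique (n := n) (r := 0) (by omega) (by rw [← h, add_zero])
  simp [seqTok, h2]

lemma map_some_append_sep {g a : ℕ} (h : g * (n + 2) = a) :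
    (List.ofFn (P.state x g)).map some ++ [none] =
      (List.range (n + 1)).map fun c => seqTok P x (a + c) := by
  rw [List.range_succ, List.map_append]
  congr 1
  · refine List.ext_getElem (by simp) fun j h1 h2 => ?_
    have hj : j < n := by simpa using h1
    simp only [List.getElem_map, List.getElem_ofFn, List.getElem_range]
    exact (seqTok_state P x (j := ⟨j, hj⟩) (by simp; omega)).symm
  · simp only [List.map_cons, List.map_nil]
    -- The separator closing one state is place 0 of the next block.
    rw [seqTok_sep P x (g := g + 1) (by rw [add_mul]; omega)]

lemma prompt_append_cot (N : ℕ) :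
    prompt x ++ cot P x N = (List.range (n + 1 + N * (n + 2))).map (seqTok P x) := by
  induction N with
  | zero =>
    have := map_some_append_sep P x (g := 0) (a := 0) (by simp)
    simpa [cot, prompt, MTParams.state] using this
  | succ N ih =>
    have hc : cot P x (N + 1) = cot P x N ++ cotBlock P x N := by
      simp [cot, List.range_succ]
    rw [hc, ← List.append_assoc, ih, add_mul, one_mul, ← add_assoc,
      List.range_add (n := n + 1 + N * (n + 2)), List.map_append]
    congr 1
    rw [List.range_succ_eq_map, cotBlock,
      map_some_append_sep P x (g := N + 1) (a := n + 1 + N * (n + 2) + 1) (by ring)]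
    simp only [List.map_cons, List.map_map]
    rw [seqTok_output P x (g := N) (by ring)]
    congr 1
    refine List.map_congr_left fun c _ => ?_
    simp only [Function.comp_apply]
    congr 1
    omega

/-- Block `g` holds the state after `g` steps. The words fetched from block `g - 1` are therefore
the operands of step `g - 1`, and the twist yields the entry that this step overwrites. -/
lemma newWord_seqTok {i : ℕ} (hi : grp n i ≠ 0) :
    newWord n P (seqTok P x) i = P.state x (grp n i) (Fin.ofNat n (grp n i - 1)) := by
  have hf (s : ℕ) : word (seqTok P x (fetchSrc n s i)) =
      P.state x (grp n i - 1) (Fin.ofNat n (grp n i - 1 + s)) := by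
    have h1 := fetchOff_mem (n := n) s (grp n i)
    have h2 : seqTok P x (fetchSrc n s i) =
        some (P.state x (grp n i - 1) (Fin.ofNat n (grp n i - 1 + s))) := by
      refine seqTok_state P x ?_
      rw [fetchSrc]
      have : fetchOff n s (grp n i) = (grp n i - 1 + s) % n + 2 := by
        simp [fetchOff, hi, add_comm]
      simp only [Fin.val_ofNat]
      omega
    rw [h2]
    rfl
  obtain ⟨g, hg⟩ := Nat.exists_eq_succ_of_ne_zero hi
  rw [newWord, hf, hf, hf, hg]
  simp only [Nat.succ_eq_add_one, Nat.add_sub_cancel, MTParams.state, Function.update_self]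
  rfl

/-- The exact computation predicts the next token. -/
lemma seqTok_succ {i : ℕ} (hi : grp n i ≠ 0) :
    seqTok P x (i + 1) =
      if off n i = n + 1 then none else some (outWord n P (seqTok P x) i) := by
  have h := grp_mul_add_off (n := n) i
  have hlt := off_lt (n := n) i
  obtain ⟨g, hg⟩ := Nat.exists_eq_succ_of_ne_zero hi
  rw [Nat.succ_eq_add_one] at hg
  have hm := Nat.mod_lt g (Nat.pos_of_neZero n)
  split_ifs with hs
  · refine seqTok_sep P x (g := grp n i + 1) ?_
    rw [add_mul]
    omega
  · by_cases h0 : off n i = 0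
    · rw [seqTok_output P x (g := g) (by rw [← hg]; omega), outWord, if_pos h0,
        newWord_seqTok P x hi, hg]
      rfl
    · have h1 : seqTok P x (i + 1) = some (P.state x (grp n i) ⟨off n i - 1, by omega⟩) :=
        seqTok_state P x (by simp only; omega)
      rw [h1, outWord, if_neg h0]
      congr 1
      by_cases he : off n i = 1 + (grp n i - 1) % n
      · rw [if_pos he, newWord_seqTok P x hi]
        congr 1
        exact Fin.ext (by simp only [Fin.val_ofNat]; omega)
      -- Place `r` predicts place `r + 1`, which holds word `r - 1`. A word that the step does not
      -- overwrite stands at the same place one block earlier.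
      · have h2 : seqTok P x (copySrc n i) = some (P.state x g ⟨off n i - 1, by omega⟩) := by
          refine seqTok_state P x ?_
          have hc : copyOff n (off n i) = off n i + 1 := by simp [copyOff, h0, hs]
          rw [copySrc, if_neg hi, hc, hg, Nat.add_sub_cancel]
          simp only
          omega
        rw [if_neg he, if_neg hs, h2, hg, MTParams.state, Function.update_of_ne]
        · rfl
        · intro h'
          have := congrArg Fin.val h'
          simp only [Fin.val_ofNat] at this
          rw [hg, Nat.add_sub_cancel] at he
          omega

end Sequence

/-! ## The Transformer -/

section Model

variable {n N w : ℕ}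

/-- The output form of a token: for a number the agreement of its bits with the input bits, for
the separator the indicator of the last place of a block. -/
def outForm : Token w → Reg n N w → ℤ
  | some v => (∑ c : Fin w, inForm c (2 * (2 * ibit v c - 1))) +
      constForm (-∑ c : Fin w, (2 * ibit v c - 1))
  -- The separator gets `w + 1` at the last place of a block, above the maximum `w` of any number.
  -- Elsewhere it gets `-1`, below the correct number's `w` even when `w = 0`.
  | none => regForm 1 (fun s => if s = n + 1 then (w + 2 : ℤ) else 0) - constForm 1

lemma abs_sum_fin_le {f : Fin w → ℤ} {b : ℤ} (hf : ∀ c, |f c| ≤ b) : |∑ c, f c| ≤ w * b :=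
  (Finset.abs_sum_le_sum_abs _ _).trans
    ((Finset.sum_le_sum fun c _ => hf c).trans (by simp))

lemma abs_two_mul_ibit_sub_one_le (v : BitVec w) (s : ℕ) : |2 * ibit v s - 1| ≤ 1 := by
  unfold ibit; split_ifs <;> simp

lemma abs_outForm_le {R : ℕ} (hR : 3 * w + 3 ≤ R) (v : Token w) (a : Reg n N w) :
    |outForm v a| ≤ R := by
  rcases v with _ | v
  · have h1 := abs_le.1 (abs_regForm_le (k := 1) (f := fun s => if s = n + 1 then (w + 2 : ℤ) else 0)
      (by positivity : (0 : ℤ) ≤ w + 2) (fun s _ => by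
        split_ifs
        · rw [abs_of_nonneg (by positivity)]
        · simpa using by positivity) a)
    have h2 := abs_le.1 (abs_constForm_le 1 a)
    rw [abs_one] at h2
    rw [outForm, abs_le, Pi.sub_apply]
    omega
  · have h1 : |(∑ c : Fin w, inForm c (2 * (2 * ibit v c - 1)) : Reg n N w → ℤ) a| ≤ w * 2 := by
      rw [Finset.sum_apply]
      refine abs_sum_fin_le fun c => (abs_inForm_le _ _ _).trans ?_
      rw [abs_mul]
      have := abs_two_mul_ibit_sub_one_le v c
      simp only [Nat.abs_ofNat]
      omega
    have h2 : |∑ c : Fin w, (2 * ibit v c - 1)| ≤ w * 1 :=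
      abs_sum_fin_le fun c => abs_two_mul_ibit_sub_one_le v c
    have h3 := abs_constForm_le (n := n) (N := N) (-∑ c : Fin w, (2 * ibit v c - 1)) a
    rw [abs_neg] at h3
    refine (abs_add_le _ _).trans ?_
    omega

variable {P : MTParams w} {tok : ℕ → Token w}

lemma regs_outForm_some {l i : ℕ} (hl : 12 < l) (v : BitVec w) :
    regs n N P tok l i ⬝ᵥ outForm (some v) =
      ∑ c : Fin w, (2 * ibit (outWord n P tok i) c - 1) * (2 * ibit v c - 1) := by
  have h (c : Fin w) : regs n N P tok l i ⬝ᵥ inForm c (2 * (2 * ibit v c - 1)) =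
      ibit (outWord n P tok i) c * (2 * (2 * ibit v c - 1)) := by
    rw [dotProduct_inForm _ (by omega)]
    have : ¬ l ≤ 12 := by omega
    simp [regs, this]
  rw [outForm, dotProduct_add, dotProduct_sum, regs_dotProduct_const, ← sub_eq_add_neg,
    ← Finset.sum_sub_distrib]
  exact Finset.sum_congr rfl fun c _ => by rw [h]; ring

lemma regs_outForm_none {l i : ℕ} (hl : 12 < l) :
    regs n N P tok l i ⬝ᵥ outForm none = (if off n i = n + 1 then (w + 2 : ℤ) else 0) - 1 := by
  rw [outForm, dotProduct_sub, regs_dotProduct_const, regs_dotProduct_off (by omega)]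

lemma sign_mul_le (v v' : BitVec w) (s : ℕ) : (2 * ibit v s - 1) * (2 * ibit v' s - 1) ≤ 1 := by
  unfold ibit; split_ifs <;> simp

lemma sum_sign_le (v v' : BitVec w) :
    ∑ c : Fin w, (2 * ibit v c - 1) * (2 * ibit v' c - 1) ≤ w :=
  (Finset.sum_le_sum fun (c : Fin w) _ => sign_mul_le v v' c).trans (by simp)

lemma sum_sign_self (v : BitVec w) :
    ∑ c : Fin w, (2 * ibit v c - 1) * (2 * ibit v c - 1) = w := by
  have h (c : Fin w) : (2 * ibit v c - 1) * (2 * ibit v c - 1) = 1 := by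
    unfold ibit; split_ifs <;> simp
  simp [h]

/-- In signs ±1 the sum counts agreements minus disagreements, so a single differing bit lowers it.
-/
lemma sum_sign_lt {v v' : BitVec w} (hv : v' ≠ v) :
    ∑ c : Fin w, (2 * ibit v c - 1) * (2 * ibit v' c - 1) < w := by
  obtain ⟨c, hc, hne⟩ : ∃ c, c < w ∧ v.getLsbD c ≠ v'.getLsbD c := by
    by_contra hcon
    push Not at hcon
    exact hv (BitVec.eq_of_getLsbD_eq fun c hc => (hcon c hc).symm)
  have : ∑ c : Fin w, (2 * ibit v c - 1) * (2 * ibit v' c - 1) < ∑ _c : Fin w, (1 : ℤ) := by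
    refine Finset.sum_lt_sum (fun c _ => sign_mul_le v v' c) ⟨⟨c, hc⟩, Finset.mem_univ _, ?_⟩
    unfold ibit
    cases h1 : v.getLsbD c <;> cases h2 : v'.getLsbD c <;> simp_all
  simpa using this

lemma regs_outForm_lt {l i : ℕ} (hl : 12 < l) {v' : Token w}
    (hv : v' ≠ if off n i = n + 1 then none else some (outWord n P tok i)) :
    regs n N P tok l i ⬝ᵥ outForm v' <
      regs n N P tok l i ⬝ᵥ outForm (if off n i = n + 1 then none else some (outWord n P tok i)) := by
  split_ifs at hv ⊢ with h
  · obtain ⟨v', rfl⟩ := Option.ne_none_iff_exists'.1 hv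
    rw [regs_outForm_some hl, regs_outForm_none hl, if_pos h]
    have := sum_sign_le (outWord n P tok i) v'
    omega
  · rw [regs_outForm_some hl, sum_sign_self]
    rcases v' with _ | v'
    · rw [regs_outForm_none hl, if_neg h]
      omega
    · rw [regs_outForm_some hl]
      exact sum_sign_lt fun h' => hv (by rw [h'])

/-- The Transformer with precision `p`. -/
noncomputable def mtTransformer (P : MTParams w) (n N p : ℕ) :
    Transformer (Token w) (hiddenDim n N w) where
  embed v c := bit v c
  pos j c := if (c : ℕ) = w then (j : ℝ) else if (c : ℕ) = w + 1 then 1 else 0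
  layers := (List.range 17).map fun l => (mtGates P n N l).toLayer (regEquiv n N w) (2 ^ p)
  unembed v c := place (regEquiv n N w) (outForm v) c

lemma bit_eq_ibit (t : Token w) (c : ℕ) : bit t c = (ibit (word t) c : ℝ) := by
  rcases t with _ | v
  · simp [bit, ibit, word]
  · change (if v.getLsbD c then (1 : ℝ) else 0) = ((if v.getLsbD c then 1 else 0 : ℤ) : ℝ)
    split_ifs <;> simp

lemma place_regEquiv_inl (x : Reg n N w → ℤ) {c : Fin (hiddenDim n N w)} (hc : (c : ℕ) < w + 2) :
    place (regEquiv n N w) x c = x (.inl ⟨c, hc⟩) := by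
  have : c = regEquiv n N w (.inl ⟨c, hc⟩, 0) := 
    Fin.ext (regEquiv_inl (n := n) (N := N) ⟨c, hc⟩).symm
  conv_lhs => rw [this]
  simp [place]

lemma place_regs_zero (i : ℕ) (c : Fin (hiddenDim n N w)) :
    (place (regEquiv n N w) (regs n N P tok 0 i) c : ℝ) = bit (tok i) c +
      if (c : ℕ) = w then ((i + 1 : ℕ) : ℝ) else if (c : ℕ) = w + 1 then 1 else 0 := by
  rw [bit_eq_ibit]
  by_cases hc : (c : ℕ) < w + 2
  · rw [place_regEquiv_inl _ hc]
    by_cases h1 : (c : ℕ) < w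
    · have h2 : (c : ℕ) ≠ w := by omega
      have h3 : (c : ℕ) ≠ w + 1 := by omega
      simp [regs, h1, h2, h3]
    · have h0 := ibit_eq_zero (v := word (tok i)) (not_lt.1 h1)
      by_cases h2 : (c : ℕ) = w
      · rw [h0]
        simp [regs, h2]
      · have h3 : (c : ℕ) = w + 1 := by omega
        rw [h0]
        simp [regs, h3]
  · have h2 : (c : ℕ) ≠ w := by omega
    have h3 : (c : ℕ) ≠ w + 1 := by omega
    rw [ibit_eq_zero (by omega)]
    simp only [h2, h3, if_false, Int.cast_zero, add_zero, Int.cast_eq_zero]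
    obtain ⟨⟨o, k⟩, rfl⟩ := (regEquiv n N w).surjective c
    unfold place
    split_ifs with hk
    · simp only [Equiv.symm_apply_apply] at hk ⊢
      subst hk
      rcases o with c | ⟨k, s⟩
      · rw [regEquiv_inl] at hc
        omega
      · simp [regs]
    · rfl

variable {p R : ℕ} {B : ℝ}

lemma allParams_mtTransformer [NeZero n] (hR : 2 * ((n + N + w + 2) * (n + 2)) + 20 ≤ R)
    (hB : 2 ^ p * (R : ℝ) ^ 4 ≤ B) : (mtTransformer P n N p).AllParams (FixedPoint p B) := by
  have hR1 : (1 : ℝ) ≤ R := by exact_mod_cast (by omega : 1 ≤ R)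
  have hΛ : (1 : ℝ) ≤ 2 ^ p := one_le_pow₀ (by norm_num)
  have hRR : (R : ℝ) ≤ R ^ 4 := le_self_pow₀ hR1 (by norm_num)
  have hB' : 2 ^ p * (R : ℝ) ≤ B :=
    (mul_le_mul_of_nonneg_left hRR (by positivity)).trans hB
  have hBR : (R : ℝ) ≤ B := (le_mul_of_one_le_left (by positivity) hΛ).trans hB'
  have hint (z : ℤ) (hz : |z| ≤ R) : FixedPoint p B z := by
    refine ⟨le_trans ?_ hBR, z * 2 ^ p, by push_cast; field_simp⟩
    exact_mod_cast hz
  have hw : 3 * w + 3 ≤ R := by nlinarith [Nat.pos_of_neZero n]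
  refine ⟨fun v c => ?_, fun v c => ?_, fun lay hlay => ?_⟩
  · change FixedPoint p B (bit v c)
    rw [bit_eq_ibit]
    exact hint _ ((abs_ibit_le _ _).trans (by omega))
  · exact hint _ (abs_place_le _ (by positivity) (abs_outForm_le hw v) c)
  · obtain ⟨l, -, rfl⟩ := List.mem_map.1 hlay
    exact Gates.allParams_toLayer (bounded_mtGates hR l) hB' (hR1.trans hBR)

/-- The exponent is 187 = 17 · 11. The bound on `i` keeps the block number at most `N`, so that its
one-hot code fits into the array; the final separator is generated but never read. -/
lemma final_approx [NeZero n] (hR : 2 * ((n + N + w + 2) * (n + 2)) + 20 ≤ R)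
    (hd : hiddenDim n N w ≤ R) (hB : 2 ^ p * (R : ℝ) ^ 4 ≤ B)
    (hp : (R : ℝ) ^ 187 * (1 / 2 ^ p) ≤ 1) {ρ : ℝ → ℝ} (hρ : IsRounding p B ρ)
    {i : ℕ} (hi : i + 3 ≤ (N + 1) * (n + 2)) {s : List (Token w)}
    (hs : s = (List.range (i + 1)).map tok) (c : Fin (hiddenDim n N w)) :
    |(mtTransformer P n N p).final ρ s c - place (regEquiv n N w) (regs n N P tok 17 i) c| ≤
      (R : ℝ) ^ 187 * (1 / 2 ^ p) := by
  have hlen : s.length = i + 1 := by simp [hs]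
  have hiR : i + 3 ≤ R := hi.trans (by nlinarith)
  have hgrp (j : ℕ) (hj : j < s.length) : grp n j ≤ N := by
    rw [grp, ← Nat.lt_succ_iff, Nat.div_lt_iff_lt_mul (by omega), Nat.succ_eq_add_one]
    omega
  have h0 : 0 < s.length := by omega
  rw [Transformer.final, dif_pos h0]
  have key := Gates.foldl_approx (e := regEquiv n N w) (K := 17) (R := R) hρ (by omega) hd
    (by simp [hiddenDim]) (by omega : s.length ≤ R) hB hp
    (D := mtGates P n N) (fun l _ => bounded_mtGates hR l)
    (X := fun l (i : Fin s.length) => regs n N P tok l i)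
    (fun l _ => step_mtGates hgrp l)
    (fun l _ j o => abs_regs_le (by have := j.is_lt; omega) l o)
    (Z := (mtTransformer P n N p).input s) (fun j c => ?_)
    ⟨s.length - 1, Nat.sub_lt h0 Nat.one_pos⟩ c
  · rw [show i = s.length - 1 by omega]
    exact key
  · rw [place_regs_zero]
    have hj : s.get j = tok j := by simp [hs]
    simp only [Transformer.input, mtTransformer, Pi.add_apply, hj]

/-- Exact logits are integers, so the winner leads by at least 1. The output error and the rounding
of a logit together stay below 1/4, hence the order survives; the softmax is monotone in the logit.
-/
lemma isNext_of_approx {d : ℕ} {T : Transformer (Token w) d} {u : Token w → Fin d → ℤ}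
    (hT : ∀ v c, T.unembed v c = u v c) (hR : 9 ≤ R) (hd : d ≤ R) (hu : ∀ v c, |u v c| ≤ R)
    (hB : (R : ℝ) ^ 4 ≤ B) {ρ : ℝ → ℝ} (hρ : IsRounding p B ρ) {η : ℝ}
    (hη : (R : ℝ) ^ 3 * η ≤ 1) (hpη : 1 / 2 ^ p ≤ η)
    {s : List (Token w)} {y : Fin d → ℤ} (hy : ∀ c, |y c| ≤ R)
    (happ : ∀ c, |T.final ρ s c - y c| ≤ η) {v : Token w}
    (hv : ∀ v' ≠ v, y ⬝ᵥ u v' < y ⬝ᵥ u v) : T.IsNext ρ s v := by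
  have hR' : (9 : ℝ) ≤ R := by exact_mod_cast hR
  have hη0 : 0 < η := lt_of_lt_of_le (by positivity) hpη
  have hR2 : 81 ≤ (R : ℝ) ^ 2 := by nlinarith
  have hR3 : 9 * (R : ℝ) ^ 2 ≤ (R : ℝ) ^ 3 := by nlinarith
  have hR4 : 9 * (R : ℝ) ^ 3 ≤ (R : ℝ) ^ 4 := by nlinarith
  have hη2 : 9 * ((R : ℝ) ^ 2 * η) ≤ 1 := by nlinarith
  have hη1 : 81 * η ≤ (R : ℝ) ^ 2 * η := mul_le_mul_of_nonneg_right hR2 hη0.le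
  have hcard : (Fintype.card (Fin d) : ℝ) ≤ R := by simpa using hd
  have cast {z : ℤ} (hz : |z| ≤ R) : |(z : ℝ)| ≤ (R : ℝ) := by exact_mod_cast hz
  have hdiff (v) : |T.final ρ s ⬝ᵥ T.unembed v - ((y ⬝ᵥ u v : ℤ) : ℝ)| ≤ R ^ 2 * η := by
    have : T.final ρ s ⬝ᵥ T.unembed v - ((y ⬝ᵥ u v : ℤ) : ℝ) =
        ∑ c, (T.final ρ s c - y c) * u v c := by
      simp only [dotProduct, hT]
      push_cast
      rw [← Finset.sum_sub_distrib]
      exact Finset.sum_congr rfl fun c _ => by ring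
    rw [this]
    calc _ ≤ R * (η * R) :=
          abs_sum_mul_le hη0.le (by linarith) hcard happ (fun c => cast (hu v c))
      _ = R ^ 2 * η := by ring
  have hlog (v) : |ρ (T.final ρ s ⬝ᵥ T.unembed v) - ((y ⬝ᵥ u v : ℤ) : ℝ)| ≤ 1 / 4 := by
    have h1 : |((y ⬝ᵥ u v : ℤ) : ℝ)| ≤ R ^ 3 := by
      have : ((y ⬝ᵥ u v : ℤ) : ℝ) = ∑ c, (y c : ℝ) * u v c := by
        simp only [dotProduct]; push_cast; rfl
      rw [this]
      calc _ ≤ (R : ℝ) * (R * R) :=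
            abs_sum_mul_le (by linarith) (by linarith) hcard (fun c => cast (hy c))
              (fun c => cast (hu v c))
        _ = (R : ℝ) ^ 3 := by ring
    have h2 := abs_sub_abs_le_abs_sub (T.final ρ s ⬝ᵥ T.unembed v) ((y ⬝ᵥ u v : ℤ) : ℝ)
    have h3 := hρ (T.final ρ s ⬝ᵥ T.unembed v) (by linarith [hdiff v])
    have h4 := hdiff v
    rw [abs_le] at h3 h4 ⊢
    constructor <;> linarith [h3.1, h3.2, h4.1, h4.2]
  intro v' hne
  have hlt : ((y ⬝ᵥ u v' : ℤ) : ℝ) + 1 ≤ ((y ⬝ᵥ u v : ℤ) : ℝ) := by exact_mod_cast hv v' hne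
  have h1 := abs_le.1 (hlog v)
  have h2 := abs_le.1 (hlog v')
  refine div_lt_div_of_pos_right (Real.exp_lt_exp.2 (by linarith [h1.1, h2.2])) ?_
  exact Finset.sum_pos (fun _ _ => Real.exp_pos _) Finset.univ_nonempty

lemma place_dotProduct (x y : Reg n N w → ℤ) :
    place (regEquiv n N w) x ⬝ᵥ place (regEquiv n N w) y = x ⬝ᵥ y := by
  have := sum_place_mul (K := ℤ) (regEquiv n N w) x (place (regEquiv n N w) y)
  simp only [Int.cast_id] at this
  rw [dotProduct, this]
  simp [place, dotProduct]

/-- Needed for the bit approximation at separators; it also shows that the earlier cases in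
`outWord` do not interfere. -/
lemma outWord_of_off_eq [NeZero n] {i : ℕ} (h : off n i = n + 1) :
    outWord n P tok i = 0#w := by
  have := Nat.mod_lt (grp n i - 1) (Nat.pos_of_neZero n)
  rw [outWord, if_neg (by omega), if_neg (by omega), if_pos h]

lemma generates_mtTransformer [NeZero n] (hR : 2 * ((n + N + w + 2) * (n + 2)) + 20 ≤ R)
    (hd : hiddenDim n N w ≤ R) (hB : 2 ^ p * (R : ℝ) ^ 4 ≤ B)
    {ε : ℝ} (hε : (R : ℝ) ^ 187 * (1 / 2 ^ p) ≤ ε)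
    (hp : (R : ℝ) ^ 190 * (1 / 2 ^ p) ≤ 1) {ρ : ℝ → ℝ} (hρ : IsRounding p B ρ)
    (x : Fin n → BitVec w) :
    (mtTransformer P n N p).Generates ρ (prompt x) (cot P x N) ∧
      ApproximatesBits (mtTransformer P n N p) ρ ε (prompt x) (cot P x N) := by
  have hR1 : (1 : ℝ) ≤ R := by exact_mod_cast (by omega : 1 ≤ R)
  have hΛ : (1 : ℝ) ≤ 2 ^ p := one_le_pow₀ (by norm_num)
  have hδ : (0 : ℝ) < 1 / 2 ^ p := by positivity
  have h190 : (R : ℝ) ^ 190 * (1 / 2 ^ p) = R ^ 3 * (R ^ 187 * (1 / 2 ^ p)) := by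
    rw [← mul_assoc, ← pow_add]
  have h187 : (R : ℝ) ^ 187 * (1 / 2 ^ p) ≤ 1 := by
    refine le_trans ?_ hp
    rw [h190]
    exact le_mul_of_one_le_left (by positivity) (one_le_pow₀ hR1)
  have hall := prompt_append_cot P x N
  have hplen : (prompt x).length = n + 1 := by simp [prompt]
  have hclen : (cot P x N).length = N * (n + 2) := by
    have := congrArg List.length hall
    simp only [List.length_append, List.length_map, List.length_range, hplen] at this
    omega
  have hseq (k : ℕ) (hk : k < (cot P x N).length) :
      prompt x ++ (cot P x N).take k = (List.range (n + k + 1)).map (seqTok P x) ∧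
      (cot P x N)[k] = if off n (n + k) = n + 1 then none
        else some (outWord n P (seqTok P x) (n + k)) := by
    constructor
    · have : prompt x ++ (cot P x N).take k = (prompt x ++ cot P x N).take (n + k + 1) := by
        rw [List.take_append, hplen,
          List.take_of_length_le (by omega : (prompt x).length ≤ n + k + 1),
          show n + k + 1 - (n + 1) = k by omega]
      rw [this, hall, ← List.map_take, List.take_range]
      congr 2
      omega
    -- The prompt's separator, at index `n`, already opens block 1, so every prediction is made from
    -- block 1 or later.
    · have hg : grp n (n + k) ≠ 0 := by
        rw [grp, Nat.div_ne_zero_iff]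
        omega
      rw [← seqTok_succ P x hg]
      have h1 : (prompt x ++ cot P x N)[n + k + 1]? = some (seqTok P x (n + k + 1)) := by
        rw [hall, List.getElem?_map, List.getElem?_range (by omega)]
        rfl
      rw [List.getElem?_append_right (by omega), hplen,
        show n + k + 1 - (n + 1) = k by omega, List.getElem?_eq_getElem hk] at h1
      exact Option.some.inj h1
  have happ (k : ℕ) (hk : k < (cot P x N).length) :=
    final_approx (P := P) hR hd hB h187 hρ (i := n + k) (by rw [add_mul]; omega) (hseq k hk).1
  have hiR (k : ℕ) (hk : k < (cot P x N).length) : n + k + 1 ≤ R := by nlinarith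
  have hw : 3 * w + 3 ≤ R := by nlinarith [Nat.pos_of_neZero n]
  refine ⟨fun k hk => ?_, fun k hk c hc => ?_⟩
  · rw [(hseq k hk).2]
    refine isNext_of_approx (u := fun v => place (regEquiv n N w) (outForm v)) (fun v c => rfl)
      (by omega) hd (fun v c => abs_place_le _ (by positivity) (abs_outForm_le hw v) c)
      ((le_mul_of_one_le_left (by positivity) hΛ).trans hB) hρ (h190 ▸ hp)
      (le_mul_of_one_le_left hδ.le (one_le_pow₀ hR1))
      (fun c => abs_place_le _ (by positivity) (abs_regs_le (hiR k hk) 17) c) (happ k hk)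
      fun v' hne => ?_
    simp only [place_dotProduct]
    exact regs_outForm_lt (by norm_num) hne
  · refine le_trans (le_of_eq ?_) ((happ k hk c).trans hε)
    rw [place_regEquiv_inl _ (by omega), bit_eq_ibit, (hseq k hk).2]
    congr 3
    simp only [regs, hc, if_true, show ¬ 17 ≤ 12 by norm_num, if_false]
    split_ifs with h
    · rw [outWord_of_off_eq h]; rfl
    · rfl

end Model

end MTTransformer

open MTTransformer in
theorem mainTheorem2 (ε : ℝ) (hε : 0 < ε) :
    ∃ C k : ℕ, ∀ (n N w : ℕ) [NeZero n] (P : MTParams w),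
      ∃ (d : ℕ) (T : Transformer (Token w) d) (p : ℕ) (B : ℝ),
        d ≤ C * (n + N + w) ∧
        T.layers.length = 17 ∧
        (∀ lay ∈ T.layers, lay.H ≤ 4) ∧
        B ≤ (C : ℝ) * ((n + N + w : ℕ) : ℝ) ^ k ∧
        2 ^ p ≤ C * (n + N + w) ^ k ∧
        T.AllParams (FixedPoint p B) ∧
        BinaryInput T ∧
        ∀ ρ : ℝ → ℝ, IsRounding p B ρ → ∀ x : Fin n → BitVec w,
          T.Generates ρ (prompt x) (cot P x N) ∧
          ApproximatesBits T ρ ε (prompt x) (cot P x N) := by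
  obtain ⟨E, hE⟩ := exists_nat_ge (1 / ε)
  have hE0 : 0 < (E : ℝ) := lt_of_lt_of_le (by positivity) hE
  have hE1 : 1 ≤ E := by exact_mod_cast hE0
  -- These come from `2 ^ p * R ^ 4 ≤ 2 * E * R ^ 194` with `R = 200 * (n + N + w) ^ 2`.
  refine ⟨2 * E * 200 ^ 194, 388, fun n N w _ P => ?_⟩
  have hn := Nat.pos_of_neZero n
  -- `R` is quadratic because of the weights of size `(n + N + w + 2) * (n + 2)`; as `n + N + w ≥
  -- 1`, the factor 200 absorbs the additive constants.
  obtain ⟨R, hRdef⟩ : ∃ R, R = 200 * (n + N + w) ^ 2 := ⟨_, rfl⟩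
  have hK1 : 1 ≤ n + N + w := by omega
  have hR : 2 * ((n + N + w + 2) * (n + 2)) + 20 ≤ R := by rw [hRdef]; nlinarith
  have hd : hiddenDim n N w ≤ R := by rw [hRdef, hiddenDim]; nlinarith
  have hR1 : 1 ≤ R := by omega
  have hT1 : 1 ≤ E * R ^ 190 := Nat.mul_pos hE1 (pow_pos hR1 _)
  -- The precision is `q + 1`: the first power of two above `E * R ^ 190`, at most twice that
  -- number. The exponent 190 = 187 + 3 leaves `R ^ 3` for the logits, and `E ≥ 1 / ε` brings the
  -- output error below `ε`.
  obtain ⟨q, hq1, hq2⟩ := exists_nat_pow_near hT1 one_lt_two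
  have hpow : 2 ^ (q + 1) * R ^ 4 ≤ 2 * E * 200 ^ 194 * (n + N + w) ^ 388 := by
    calc 2 ^ (q + 1) * R ^ 4 = 2 * 2 ^ q * R ^ 4 := by rw [pow_succ' 2 q]
      _ ≤ 2 * (E * R ^ 190) * R ^ 4 := by gcongr
      _ = 2 * E * R ^ 194 := by rw [mul_assoc, mul_assoc E, ← pow_add, mul_assoc]
      _ = 2 * E * 200 ^ 194 * (n + N + w) ^ 388 := by
          rw [hRdef, mul_pow, ← pow_mul, mul_assoc (2 * E)]
  have hlarge : (E : ℝ) * R ^ 190 ≤ 2 ^ (q + 1) := by exact_mod_cast hq2.le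
  have hRR : (1 : ℝ) ≤ R := by exact_mod_cast hR1
  have hp : (R : ℝ) ^ 190 * (1 / 2 ^ (q + 1)) ≤ 1 := by
    rw [mul_one_div, div_le_one (by positivity)]
    exact (le_mul_of_one_le_left (by positivity) (by exact_mod_cast hE1)).trans hlarge
  have hε' : (R : ℝ) ^ 187 * (1 / 2 ^ (q + 1)) ≤ ε := by
    rw [mul_one_div, div_le_iff₀ (by positivity)]
    have h1 : 1 ≤ ε * E := by
      rw [div_le_iff₀ hε] at hE
      linarith
    calc (R : ℝ) ^ 187 ≤ R ^ 190 := pow_le_pow_right₀ hRR (by norm_num)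
      _ ≤ ε * E * R ^ 190 := le_mul_of_one_le_left (by positivity) h1
      _ = ε * (E * R ^ 190) := by ring
      _ ≤ ε * 2 ^ (q + 1) := by gcongr
  refine ⟨hiddenDim n N w, mtTransformer P n N (q + 1), q + 1, 2 ^ (q + 1) * (R : ℝ) ^ 4,
    ?_, by simp [mtTransformer], fun lay hlay => ?_, by exact_mod_cast hpow,
    (Nat.le_mul_of_pos_right _ (pow_pos hR1 _)).trans hpow,
    allParams_mtTransformer hR le_rfl, ⟨?_, fun v c => rfl, fun j c => rfl⟩,
    fun ρ hρ x => generates_mtTransformer hR hd le_rfl hε' hp hρ x⟩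
  · have h1 : 200 ≤ 2 * E * 200 ^ 194 :=
      (Nat.le_self_pow (by norm_num) 200).trans (Nat.le_mul_of_pos_left _ (by omega))
    refine le_trans ?_ (Nat.mul_le_mul_right _ h1)
    rw [hiddenDim]
    omega
  · obtain ⟨l, -, rfl⟩ := List.mem_map.1 hlay
    change 1 ≤ 4
    norm_num
  · rw [hiddenDim]
    omega
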